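/- For integers $k\ge 1$ and $n\ge 1$ let $d_k(n)$ be the number of ordered $k$-tuples of positive integers with product $n$. For $z>0$ let $$G_k(z):=G_{0,\,2k}^{k+1,\,0}\Big(\begin{matrix}\text{---}\\ (0)_k,\tfrac12:\left(\tfrac12\right)_{k-1}\end{matrix}\,\Big|\,z\Big)=\frac{1}{2\pi i}\int_{C-i\infty}^{C+i\infty}\frac{\Gamma(-s)^k\,\Gamma\left(\tfrac12-s\right)}{\Gamma\left(\tfrac12+s\right)^{k-1}}\,z^s\,ds$$ be the Meijer $G$-function, where $(a)_r$ means that the parameter $a$ is repeated $r$ times and $C<0$ is arbitrary. For $\rho,x>0$ put $$\Psi_{\rho,k}(x):=\frac{\pi^{k/2-1}}{2^{k-1}}\sum_{j=1}^{\infty}d_k(j)\,G_k\!\left(\frac{\rho^2j^2x^2}{2^{2k}}\right).$$ Let $B_n$ be the $n$-th Bernoulli number. Then, for every non-zero integer $m$, every integer $k\ge 1$ and all $\alpha,\beta>0$ with $\alpha\beta=\pi^2$, the integrals and series involved converge absolutely and $$\begin{aligned} &(\alpha^k)^{-m}\left[\sum_{n=1}^{\infty}\frac{d_k(n)}{n^{2m+1}}\Psi_{(2\alpha)^k,k}(n)-\frac{1}{(k-1)!}\frac{d^{k-1}}{ds^{k-1}}\left(\zeta^k(2m+1+s)\,\zeta^k(s)\,\Gamma^k(s+1)\cos^{k-1}\left(\frac{\pi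 s}{2}\right)(2\alpha)^{-ks}\right)\bigg|_{s=0}\right]\\ &=(-\beta^k)^{-m}\left[\sum_{n=1}^{\infty}\frac{d_k(n)}{n^{2m+1}}\Psi_{(2\beta)^k,k}(n)-\frac{1}{(k-1)!}\frac{d^{k-1}}{ds^{k-1}}\left(\zeta^k(2m+1+s)\,\zeta^k(s)\,\Gamma^k(s+1)\cos^{k-1}\left(\frac{\pi s}{2}\right)(2\beta)^{-ks}\right)\bigg|_{s=0}\right]\\ &\quad+(-1)^{km+k+m}\left(\frac{\pi}{2}\right)^{k-1}2^{2km}\sum_{j=0}^{m+1}(-1)^{j}\frac{B_{2m-2j+2}^k\,B_{2j}^k}{(2m-2j+2)!^k\,(2j)!^k}\,\alpha^{k(m+1-j)}\beta^{kj}, \end{aligned}$$ where the finite sum is empty if $m+1<0$. -/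

import Mathlib

noncomputable section

open Complex

/-- The Piltz divisor function `d_k(n)`: the number of ordered `k`-tuples of positive integers
whose product is `n`. -/
def piltz (k n : ℕ) : ℕ := (Nat.finMulAntidiag k n).card

/-- The integrand of the Meijer G-function. The upper parameters are `a₁, …, a_n` (the list `a`)
followed by `a_{n+1}, …, a_p` (the list `a'`); the lower parameters are `b₁, …, b_m` (the list `b`)
followed by `b_{m+1}, …, b_q` (the list `b'`). -/
def meijerGIntegrand (a a' b b' : List ℂ) (z s : ℂ) : ℂ :=
  ((b.map fun w => Gamma (w - s)).prod * (a.map fun w => Gamma (1 - w + s)).prod) /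
    ((b'.map fun w => Gamma (1 - w + s)).prod * (a'.map fun w => Gamma (w - s)).prod) * z ^ s

/-- The Meijer G-function: `1 / (2πi)` times the integral of `meijerGIntegrand` along the vertical
line from `C - i∞` to `C + i∞`. The line has to separate the poles of the factors `Γ(b_j - s)`
(on its right) from those of the factors `Γ(1 - a_j + s)` (on its left). -/
def meijerG (C : ℝ) (a a' b b' : List ℂ) (z : ℂ) : ℂ :=
  1 / (2 * (Real.pi : ℂ) * I) * ∫ t : ℝ, meijerGIntegrand a a' b b' z ((C : ℂ) + (t : ℂ) * I) * I

/-- The lower parameters `(0)_k, 1/2` before the colon. -/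
def lowerLeft (k : ℕ) : List ℂ := List.replicate k 0 ++ [1 / 2]

/-- The lower parameters `(1/2)_{k-1}` after the colon. -/
def lowerRight (k : ℕ) : List ℂ := List.replicate (k - 1) (1 / 2)

/-- The `j`-th term of the series that defines `Ψ_{ρ,k}(x)`, without the constant factor. -/
def psiTerm (C ρ : ℝ) (k : ℕ) (x : ℝ) (j : ℕ) : ℂ :=
  (piltz k j : ℂ) *
    meijerG C [] [] (lowerLeft k) (lowerRight k)
      ((ρ ^ 2 * (j : ℝ) ^ 2 * x ^ 2 / 2 ^ (2 * k) : ℝ) : ℂ)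

/-- The function `Ψ_{ρ,k}(x)`, with the G-functions taken along the line `Re s = C`; as the lower
parameters before the colon are `0` and `1/2` and there are no upper ones, the line is admissible
exactly when `C < 0`. -/
def Psi (C ρ : ℝ) (k : ℕ) (x : ℝ) : ℂ :=
  (Real.pi : ℂ) ^ ((k : ℂ) / 2 - 1) / 2 ^ (k - 1) * ∑' j : ℕ+, psiTerm C ρ k x j

/-- The `n`-th term `d_k(n) n^{-2m-1} Ψ_{(2γ)^k,k}(n)`. -/
def mainTerm (C : ℝ) (m : ℤ) (k : ℕ) (γ : ℝ) (n : ℕ) : ℂ :=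
  (piltz k n : ℂ) / (n : ℂ) ^ (2 * m + 1) * Psi C ((2 * γ) ^ k) k n

/-- The function of `s` whose `(k-1)`-th derivative at `0` occurs in the transformation formula. -/
def zetaProduct (m : ℤ) (k : ℕ) (γ : ℝ) (s : ℂ) : ℂ :=
  riemannZeta (2 * (m : ℂ) + 1 + s) ^ k * riemannZeta s ^ k * Gamma (s + 1) ^ k *
    cos ((Real.pi : ℂ) * s / 2) ^ (k - 1) * ((2 * γ : ℝ) : ℂ) ^ (-(k : ℂ) * s)

/-- The bracket on either side of the transformation formula. -/
def bracket (C : ℝ) (m : ℤ) (k : ℕ) (γ : ℝ) : ℂ :=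
  (∑' n : ℕ+, mainTerm C m k γ n) -
    1 / ((k - 1).factorial : ℂ) * iteratedDeriv (k - 1) (zetaProduct m k γ) 0

end

/-! The proof is a contour shift for one kernel with a hidden symmetry. With `s = -w/2`, the
duplication and reflection formulas turn the Meijer integrand into a constant times `Γ(w)^k
cos(πw/2)^(k-1) y^(-w)`. Summing over `j` produces `ζ(w)^k`, and summing over `n` produces
`ζ(2m+1+w)^k`. Each main series is therefore `1/(2πi)` times the integral of `Γ(w)^k cos(πw/2)^(k-1)
ζ(w)^k ζ(2m+1+w)^k (2γ)^(-kw)` along a line far to the right (`hasSum_mainTerm`).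

The functional equation of `ζ` rewrites this integrand as `2^(-k) ζ(1-w)^k ζ(2m+1+w)^k (π/γ)^(kw) /
cos(πw/2)` (`mellinKernel_mul_eq_symmKernel`). The map `w ↦ -2m - w` exchanges the two zeta factors,
multiplies the cosine by `(-1)^m` and, because `αβ = π²`, exchanges `α` and `β` up to the outer
factors (`symmKernel_reflect`). So the `α`-integral on the reflected line, far to the left, is the
`β`-integral on the original line.

It remains to collect residues between the two lines (`lineInt_sub_eq_residues`). The pole of order
`k` at `0` gives the derivative term for `α`, and the pole at `-2m` is the reflection of the one for
`β`. At odd integers the cosine has a simple zero. Trivial zeros of `ζ` cancel all of these but the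
points `2(j-m-1)+1` with `0 ≤ j ≤ m+1`, where Euler's formula for `ζ(2n)` yields the Bernoulli sum
(`residue_term_eq`). The shift is legitimate because `ζ` grows polynomially in vertical strips while
`1/cos` decays exponentially. -/

section

open Complex MeasureTheory Set Filter Topology

/-! ### Residues on rectangles centred on the real axis. -/

/-- The integral of `f` along the boundary of `[a, b] × [-T, T]`, counterclockwise. -/
noncomputable def rectInt (f : ℂ → ℂ) (a b T : ℝ) : ℂ :=
  (((∫ x : ℝ in a..b, f (x + (-T : ℝ) * I)) - ∫ x : ℝ in a..b, f (x + T * I)) +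
    I * ∫ y : ℝ in -T..T, f (b + y * I)) - I * ∫ y : ℝ in -T..T, f (a + y * I)

theorem intervalIntegral_horizontal_eq_sub {F f : ℂ → ℂ} {a b y : ℝ} (hab : a ≤ b)
    (hF : ∀ x ∈ Icc a b, HasDerivAt F (f (x + y * I)) (x + y * I))
    (hf : ContinuousOn (fun x : ℝ => f (x + y * I)) (Icc a b)) :
    ∫ x : ℝ in a..b, f (x + y * I) = F (b + y * I) - F (a + y * I) := by
  have key := intervalIntegral.integral_eq_sub_of_hasDerivAt (a := a) (b := b)
    (f := fun x : ℝ => F (x + y * I)) (f' := fun x : ℝ => f (x + y * I)) ?_ ?_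
  · exact key
  · intro x hx
    rw [uIcc_of_le hab] at hx
    have h1 : HasDerivAt (fun x : ℝ => (x : ℂ) + y * I) 1 x :=
      (Complex.ofRealCLM.hasDerivAt (x := x)).add_const _
    have h2 := (hF x hx).comp_of_eq x h1 rfl
    rw [mul_one] at h2
    exact h2
  · exact (hf.mono (by rw [uIcc_of_le hab])).intervalIntegrable

theorem intervalIntegral_vertical_eq_sub {F f : ℂ → ℂ} {a b x : ℝ} (hab : a ≤ b)
    (hF : ∀ y ∈ Icc a b, HasDerivAt F (f (x + y * I)) (x + y * I))
    (hf : ContinuousOn (fun y : ℝ => f (x + y * I)) (Icc a b)) :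
    I * ∫ y : ℝ in a..b, f (x + y * I) = F (x + b * I) - F (x + a * I) := by
  rw [← intervalIntegral.integral_const_mul]
  have key := intervalIntegral.integral_eq_sub_of_hasDerivAt (a := a) (b := b)
    (f := fun y : ℝ => F (x + y * I)) (f' := fun y : ℝ => I * f (x + y * I)) ?_ ?_
  · exact key
  · intro y hy
    rw [uIcc_of_le hab] at hy
    have h1 : HasDerivAt (fun y : ℝ => (x : ℂ) + y * I) I y := by
      simpa using ((Complex.ofRealCLM.hasDerivAt (x := y)).mul_const I).const_add (x : ℂ)
    have h2 := (hF y hy).comp_of_eq y h1 rfl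
    rw [mul_comm] at h2
    exact h2
  · exact ((continuousOn_const.mul hf).mono (by rw [uIcc_of_le hab])).intervalIntegrable

theorem rectInt_eq_zero_of_hasDerivAt {F f : ℂ → ℂ} {a b T : ℝ} {p : ℝ} (hap : a < p) (hpb : p < b)
    (hT : 0 < T) (hF : ∀ w : ℂ, w ≠ p → HasDerivAt F (f w) w)
    (hf : ContinuousOn f {w | w ≠ p}) : rectInt f a b T = 0 := by
  have hne : ∀ x y : ℝ, (x ≠ p ∨ y ≠ 0) → (x : ℂ) + y * I ≠ p := by
    intro x y h h'
    rcases h with h | h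
    · exact h (by simpa using congrArg re h')
    · exact h (by simpa using congrArg im h')
  unfold rectInt
  rw [intervalIntegral_horizontal_eq_sub (F := F) (by linarith)
      (fun x _ => hF _ (hne _ _ (Or.inr (by linarith))))
      (hf.comp (by fun_prop) fun x _ => hne _ _ (Or.inr (by linarith))),
    intervalIntegral_horizontal_eq_sub (F := F) (by linarith)
      (fun x _ => hF _ (hne _ _ (Or.inr (by linarith))))
      (hf.comp (by fun_prop) fun x _ => hne _ _ (Or.inr (by linarith))),
    intervalIntegral_vertical_eq_sub (F := F) (by linarith)
      (fun x _ => hF _ (hne _ _ (Or.inl (by linarith))))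
      (hf.comp (by fun_prop) fun x _ => hne _ _ (Or.inl (by linarith))),
    intervalIntegral_vertical_eq_sub (F := F) (by linarith)
      (fun x _ => hF _ (hne _ _ (Or.inl (by linarith))))
      (hf.comp (by fun_prop) fun x _ => hne _ _ (Or.inl (by linarith)))]
  push_cast
  ring

theorem rectInt_inv_sub_pow {a b T p : ℝ} (hap : a < p) (hpb : p < b) (hT : 0 < T) (n : ℕ) :
    rectInt (fun w => ((w - p) ^ (n + 2))⁻¹) a b T = 0 := by
  refine rectInt_eq_zero_of_hasDerivAt (F := fun w => -((n + 1 : ℂ))⁻¹ * ((w - p) ^ (n + 1))⁻¹)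
    hap hpb hT (fun w hw => ?_) ?_
  · have hw' : w - p ≠ 0 := sub_ne_zero.mpr hw
    have hn : (n + 1 : ℂ) ≠ 0 := by exact_mod_cast n.succ_ne_zero
    have h := ((((hasDerivAt_id w).sub_const (p : ℂ)).pow (n + 1)).inv
      (pow_ne_zero _ hw')).const_mul (-((n + 1 : ℂ))⁻¹)
    refine h.congr_deriv ?_
    simp only [id_eq, add_tsub_cancel_right, Nat.cast_add, Nat.cast_one, mul_one, Pi.pow_apply]
    field_simp
    ring
  · intro w hw
    have hw' : w - p ≠ 0 := sub_ne_zero.mpr hw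
    exact ContinuousAt.continuousWithinAt
      (((continuous_id.sub continuous_const).pow _).continuousAt.inv₀ (pow_ne_zero _ hw'))

/-- No single branch of the logarithm is a primitive on the whole boundary. Two branches are used,
and their mismatch at the two left corners is `πi` each, which adds up to `2πi`. -/
theorem rectInt_inv_sub {a b T p : ℝ} (hap : a < p) (hpb : p < b) (hT : 0 < T) :
    rectInt (fun w => (w - p)⁻¹) a b T = 2 * Real.pi * I := by
  have hne : ∀ x y : ℝ, (x ≠ p ∨ y ≠ 0) → (x : ℂ) + y * I - p ≠ 0 := by
    intro x y h h'
    rcases h with h | h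
    · exact h (by simpa [sub_eq_zero] using congrArg re h')
    · exact h (by simpa using congrArg im h')
  have hF : ∀ w : ℂ, w - p ∈ slitPlane → HasDerivAt (fun w => log (w - p)) ((w - p)⁻¹) w := by
    intro w hw
    simpa using ((hasDerivAt_id w).sub_const (p : ℂ)).clog hw
  have hG : ∀ w : ℂ, p - w ∈ slitPlane → HasDerivAt (fun w => log (p - w)) ((w - p)⁻¹) w := by
    intro w hw
    have := ((hasDerivAt_id w).const_sub (p : ℂ)).clog hw
    refine this.congr_deriv ?_
    rw [← neg_sub (p : ℂ) w, inv_neg, id, neg_div, one_div]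
  have hcx : ∀ y : ℝ, y ≠ 0 →
      ContinuousOn (fun x : ℝ => ((x : ℂ) + y * I - p)⁻¹) (Icc a b) := fun y hy =>
    ContinuousOn.inv₀ (by fun_prop) fun x _ => hne x y (Or.inr hy)
  have hcy : ∀ x : ℝ, x ≠ p →
      ContinuousOn (fun y : ℝ => ((x : ℂ) + y * I - p)⁻¹) (Icc (-T) T) := fun x hx =>
    ContinuousOn.inv₀ (by fun_prop) fun y _ => hne x y (Or.inl hx)
  unfold rectInt
  have e1 := intervalIntegral_horizontal_eq_sub (F := fun w => log (w - p))
      (f := fun w => (w - p)⁻¹) (a := a) (b := b) (y := -T) (by linarith)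
      (fun x _ => hF _ (by rw [mem_slitPlane_iff]; right; simpa using hT.ne'))
      (hcx _ (by linarith))
  have e2 := intervalIntegral_horizontal_eq_sub (F := fun w => log (w - p))
      (f := fun w => (w - p)⁻¹) (a := a) (b := b) (y := T) (by linarith)
      (fun x _ => hF _ (by rw [mem_slitPlane_iff]; right; simpa using hT.ne'))
      (hcx _ (by linarith))
  have e3 := intervalIntegral_vertical_eq_sub (F := fun w => log (w - p))
      (f := fun w => (w - p)⁻¹) (a := -T) (b := T) (x := b) (by linarith)
      (fun x _ => hF _ (by rw [mem_slitPlane_iff]; left; simpa using hpb))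
      (hcy _ (by linarith))
  -- The left side crosses the cut of `log (w - p)`; `log (p - w)` has the same derivative and is
  -- analytic there.
  have e4 := intervalIntegral_vertical_eq_sub (F := fun w => log (p - w))
      (f := fun w => (w - p)⁻¹) (a := -T) (b := T) (x := a) (by linarith)
      (fun x _ => hG _ (by rw [mem_slitPlane_iff]; left; simpa using hap))
      (hcy _ (by linarith))
  rw [e1, e2, e3, e4]
  set u : ℂ := (a : ℂ) + T * I - p with hu
  have hu_im : u.im = T := by simp [hu]
  have h1 : (a : ℂ) + ((-T : ℝ) : ℂ) * I - p = star u := by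
    apply Complex.ext <;> simp [hu]
  have h2 : (p : ℂ) - (a + ((-T : ℝ) : ℂ) * I) = - star u := by
    apply Complex.ext <;> simp [hu]
  have h3 : (p : ℂ) - (a + T * I) = - u := by
    apply Complex.ext <;> simp [hu]
  have hlogneg : log (-u) = log u - Real.pi * I := by
    rw [log, log, norm_neg, arg_neg_eq_arg_sub_pi_of_im_pos (by rw [hu_im]; exact hT)]
    push_cast; ring
  have hlognegs : log (-star u) = log (star u) + Real.pi * I := by
    rw [log, log, norm_neg, arg_neg_eq_arg_add_pi_of_im_neg
      (by simpa [hu_im] using hT)]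
    push_cast; ring
  rw [h1, h2, h3, hlogneg, hlognegs]
  push_cast
  ring

theorem intervalIntegrable_rect_sides {f : ℂ → ℂ} {a b T p : ℝ} (hap : a < p) (hpb : p < b)
    (hT : 0 < T) (hf : ContinuousOn f ((Icc a b ×ℂ Icc (-T) T) \ {(p : ℂ)})) :
    IntervalIntegrable (fun x : ℝ => f (x + (-T : ℝ) * I)) volume a b ∧
    IntervalIntegrable (fun x : ℝ => f (x + T * I)) volume a b ∧
    IntervalIntegrable (fun y : ℝ => f (b + y * I)) volume (-T) T ∧
    IntervalIntegrable (fun y : ℝ => f (a + y * I)) volume (-T) T := by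
  have hne : ∀ x y : ℝ, x ∈ Icc a b → y ∈ Icc (-T) T → (x ≠ p ∨ y ≠ 0) →
      (x : ℂ) + y * I ∈ (Icc a b ×ℂ Icc (-T) T) \ {(p : ℂ)} := by
    intro x y hx hy h
    refine ⟨by simpa [mem_reProdIm] using ⟨hx, hy⟩, fun h' => ?_⟩
    rcases h with h | h
    · exact h (by simpa using congrArg re h')
    · exact h (by simpa using congrArg im h')
  have hab : a ≤ b := by linarith
  have hTT : -T ≤ T := by linarith
  refine ⟨?_, ?_, ?_, ?_⟩ <;> refine ContinuousOn.intervalIntegrable ?_ <;>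
    first | rw [uIcc_of_le hab] | rw [uIcc_of_le hTT]
  · exact hf.comp (by fun_prop) fun x hx => hne _ _ hx ⟨by linarith, by linarith⟩
      (Or.inr (by linarith))
  · exact hf.comp (by fun_prop) fun x hx => hne _ _ hx ⟨by linarith, by linarith⟩
      (Or.inr (by linarith))
  · exact hf.comp (by fun_prop) fun x hx => hne _ _ ⟨by linarith, by linarith⟩ hx
      (Or.inl (by linarith))
  · exact hf.comp (by fun_prop) fun x hx => hne _ _ ⟨by linarith, by linarith⟩ hx
      (Or.inl (by linarith))

theorem rectInt_add {f g : ℂ → ℂ} {a b T p : ℝ} (hap : a < p) (hpb : p < b)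
    (hT : 0 < T) (hf : ContinuousOn f ((Icc a b ×ℂ Icc (-T) T) \ {(p : ℂ)}))
    (hg : ContinuousOn g ((Icc a b ×ℂ Icc (-T) T) \ {(p : ℂ)})) :
    rectInt (fun w => f w + g w) a b T = rectInt f a b T + rectInt g a b T := by
  obtain ⟨f1, f2, f3, f4⟩ := intervalIntegrable_rect_sides hap hpb hT hf
  obtain ⟨g1, g2, g3, g4⟩ := intervalIntegrable_rect_sides hap hpb hT hg
  unfold rectInt
  rw [intervalIntegral.integral_add f1 g1, intervalIntegral.integral_add f2 g2,
    intervalIntegral.integral_add f3 g3, intervalIntegral.integral_add f4 g4]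
  ring

theorem rectInt_const_mul (c : ℂ) (f : ℂ → ℂ) (a b T : ℝ) :
    rectInt (fun w => c * f w) a b T = c * rectInt f a b T := by
  unfold rectInt
  simp only [intervalIntegral.integral_const_mul]
  ring

theorem rectInt_congr {f g : ℂ → ℂ} {a b T p : ℝ} (hap : a < p) (hpb : p < b)
    (hT : 0 < T) (h : EqOn f g ((Icc a b ×ℂ Icc (-T) T) \ {(p : ℂ)})) :
    rectInt f a b T = rectInt g a b T := by
  have hne : ∀ x y : ℝ, x ∈ Icc a b → y ∈ Icc (-T) T → (x ≠ p ∨ y ≠ 0) →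
      f ((x : ℂ) + y * I) = g ((x : ℂ) + y * I) := by
    intro x y hx hy h'
    refine h ⟨by simpa [mem_reProdIm] using ⟨hx, hy⟩, fun h'' => ?_⟩
    rcases h' with h' | h'
    · exact h' (by simpa using congrArg re h'')
    · exact h' (by simpa using congrArg im h'')
  have hab : a ≤ b := by linarith
  have hTT : -T ≤ T := by linarith
  unfold rectInt
  congr 1
  · congr 1
    · congr 1
      · refine intervalIntegral.integral_congr fun x hx => ?_
        rw [uIcc_of_le hab] at hx
        exact hne _ _ hx ⟨by linarith, by linarith⟩ (Or.inr (by linarith))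
      · refine intervalIntegral.integral_congr fun x hx => ?_
        rw [uIcc_of_le hab] at hx
        exact hne _ _ hx ⟨by linarith, by linarith⟩ (Or.inr (by linarith))
    · congr 1
      refine intervalIntegral.integral_congr fun x hx => ?_
      rw [uIcc_of_le hTT] at hx
      exact hne _ _ ⟨by linarith, by linarith⟩ hx (Or.inl (by linarith))
  · congr 1
    refine intervalIntegral.integral_congr fun x hx => ?_
    rw [uIcc_of_le hTT] at hx
    exact hne _ _ ⟨by linarith, by linarith⟩ hx (Or.inl (by linarith))

theorem rectInt_eq_zero {f : ℂ → ℂ} {a b T : ℝ} (hab : a ≤ b) (hT : 0 ≤ T)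
    (hf : DifferentiableOn ℂ f (Icc a b ×ℂ Icc (-T) T)) : rectInt f a b T = 0 := by
  have h := Complex.integral_boundary_rect_eq_zero_of_differentiableOn f
    ((a : ℂ) + (-T : ℝ) * I) ((b : ℂ) + T * I) (by
      simpa [uIcc_of_le hab, uIcc_of_le (show -T ≤ T by linarith)] using hf)
  simpa [rectInt] using h

/-- Removing the constant term and dividing by `w - p` shifts the Taylor coefficients by one. -/
theorem iteratedDeriv_dslope_div_factorial {g : ℂ → ℂ} {p : ℂ} (hg : AnalyticAt ℂ g p) (n : ℕ) :
    iteratedDeriv n (dslope g p) p / n.factorial =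
      iteratedDeriv (n + 1) g p / (n + 1).factorial := by
  have h1 := hg.hasFPowerSeriesAt
  have h2 := h1.has_fpower_series_dslope_fslope
  have h3 := (h2.analyticAt).hasFPowerSeriesAt
  have h4 := congrArg (fun q : FormalMultilinearSeries ℂ ℂ ℂ => q.coeff n)
    (h3.eq_formalMultilinearSeries h2)
  simpa [FormalMultilinearSeries.coeff_ofScalars] using h4

/-- Induction on the order of the pole: `g = g(p) + (w - p) * dslope g p` splits off a pure power,
which integrates to zero unless its exponent is `-1`, and leaves a pole of lower order. -/
theorem rectInt_div_sub_pow {a b T p : ℝ} (hap : a < p) (hpb : p < b) (hT : 0 < T) {U : Set ℂ}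
    (hU : IsOpen U) (hR : Icc a b ×ℂ Icc (-T) T ⊆ U) {g : ℂ → ℂ} (hg : DifferentiableOn ℂ g U)
    (n : ℕ) : rectInt (fun w => g w / (w - p) ^ (n + 1)) a b T =
      2 * Real.pi * I * (iteratedDeriv n g p / n.factorial) := by
  have hpU : (p : ℂ) ∈ U := hR (by
    simp only [mem_reProdIm, ofReal_re, ofReal_im]
    exact ⟨⟨by linarith, by linarith⟩, ⟨by linarith, by linarith⟩⟩)
  have hsplit : ∀ (g : ℂ → ℂ) (n : ℕ) (w : ℂ), w ≠ p → g w / (w - p) ^ (n + 1) =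
      g p * ((w - p) ^ (n + 1))⁻¹ + dslope g p w / (w - p) ^ n := by
    intro g n w hw
    have hw' : w - p ≠ 0 := sub_ne_zero.mpr hw
    have h := sub_smul_dslope g (p : ℂ) w
    rw [smul_eq_mul] at h
    rw [show g w = g p + (w - p) * dslope g p w by rw [h]; ring]
    field_simp
    ring
  have hcinv : ∀ n : ℕ, ContinuousOn (fun w : ℂ => ((w - p) ^ n)⁻¹)
      ((Icc a b ×ℂ Icc (-T) T) \ {(p : ℂ)}) := fun n =>
    ContinuousOn.inv₀ (by fun_prop) fun w hw => pow_ne_zero _ (sub_ne_zero.mpr hw.2)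
  have step : ∀ (g : ℂ → ℂ) (n : ℕ), DifferentiableOn ℂ g U →
      rectInt (fun w => g w / (w - p) ^ (n + 1)) a b T =
        g p * rectInt (fun w => ((w - p) ^ (n + 1))⁻¹) a b T +
        rectInt (fun w => dslope g p w / (w - p) ^ n) a b T := by
    intro g n hg
    rw [← rectInt_const_mul, ← rectInt_add hap hpb hT
      (f := fun w => g p * ((w - p) ^ (n + 1))⁻¹) (continuousOn_const.mul (hcinv _))]
    · exact rectInt_congr hap hpb hT fun w hw => hsplit g n w hw.2
    · have hd := ((Complex.differentiableOn_dslope (hU.mem_nhds hpU)).mpr hg).continuousOn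
      simp only [div_eq_mul_inv]
      exact (hd.mono (sdiff_subset.trans hR)).mul (hcinv _)
  induction n generalizing g with
  | zero =>
    rw [step g 0 hg]
    have hd := ((Complex.differentiableOn_dslope (hU.mem_nhds hpU)).mpr hg).mono hR
    simp only [zero_add, pow_one, pow_zero, div_one]
    rw [rectInt_inv_sub hap hpb hT, rectInt_eq_zero (by linarith) hT.le hd]
    simp
    ring
  | succ n ih =>
    have hd := (Complex.differentiableOn_dslope (hU.mem_nhds hpU)).mpr hg
    rw [step g (n + 1) hg, ih hd, rectInt_inv_sub_pow hap hpb hT, mul_zero, zero_add,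
      iteratedDeriv_dslope_div_factorial (hg.analyticAt (hU.mem_nhds hpU))]

/-! ### Exponential decay and the shift of vertical lines. -/

theorem integrable_exp_neg_abs : Integrable fun t : ℝ => Real.exp (-|t|) := by
  rw [← integrableOn_univ, ← Iic_union_Ioi (a := (0 : ℝ))]
  refine IntegrableOn.union ?_ ?_
  · refine (integrableOn_exp_Iic 0).congr_fun (fun t ht => ?_) measurableSet_Iic
    simp [abs_of_nonpos (mem_Iic.mp ht)]
  · refine (integrableOn_exp_neg_Ioi 0).congr_fun (fun t ht => ?_) measurableSet_Ioi
    simp [abs_of_pos (mem_Ioi.mp ht)]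

theorem integrable_of_continuous_of_decay {f : ℝ → ℂ} (hf : Continuous f) {A : ℝ}
    (h : ∀ t : ℝ, 1 ≤ |t| → ‖f t‖ ≤ A * Real.exp (-|t|)) : Integrable f := by
  obtain ⟨M, hM⟩ := (isCompact_Icc (a := (-1 : ℝ)) (b := 1)).exists_bound_of_continuousOn
    hf.continuousOn
  have hA : 0 ≤ A := by
    have := (norm_nonneg _).trans (h 1 (by simp))
    exact nonneg_of_mul_nonneg_left this (Real.exp_pos _)
  have hM0 : 0 ≤ M := (norm_nonneg _).trans (hM 0 (by simp))
  refine (integrable_exp_neg_abs.const_mul (A + M * Real.exp 1)).mono' hf.aestronglyMeasurable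
    (Eventually.of_forall fun t => ?_)
  rcases le_total 1 |t| with ht | ht
  · refine (h t ht).trans ?_
    gcongr
    have := Real.exp_pos 1
    nlinarith
  · refine (hM t (abs_le.mp ht)).trans ?_
    rw [add_mul, mul_assoc, ← Real.exp_add]
    have h1 : 1 ≤ Real.exp (1 + -|t|) := Real.one_le_exp (by linarith)
    have h2 := mul_nonneg hA (Real.exp_pos (-|t|)).le
    nlinarith

/-- The difference of the integrals along two vertical lines, from the integrals along the
rectangles between them. -/
theorem integral_vertical_sub {f : ℂ → ℂ} {a b A : ℝ} (hab : a ≤ b) {r : ℂ}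
    (hrect : ∀ T : ℝ, 0 < T → rectInt f a b T = 2 * Real.pi * I * r)
    (ha : Integrable fun t : ℝ => f (a + t * I)) (hb : Integrable fun t : ℝ => f (b + t * I))
    (hdecay : ∀ σ ∈ Icc a b, ∀ t : ℝ, 1 ≤ |t| → ‖f (σ + t * I)‖ ≤ A * Real.exp (-|t|)) :
    (∫ t : ℝ, f (b + t * I)) - ∫ t : ℝ, f (a + t * I) = 2 * Real.pi * r := by
  have hva := intervalIntegral_tendsto_integral ha tendsto_neg_atTop_atBot tendsto_id
  have hvb := intervalIntegral_tendsto_integral hb tendsto_neg_atTop_atBot tendsto_id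
  have hexp : Tendsto (fun T : ℝ => A * Real.exp (-T) * |b - a|) atTop (𝓝 0) := by
    simpa using ((Real.tendsto_exp_neg_atTop_nhds_zero).const_mul A).mul_const |b - a|
  have htop : Tendsto (fun T : ℝ => ∫ x : ℝ in a..b, f (x + T * I)) atTop (𝓝 0) := by
    refine squeeze_zero_norm' ?_ hexp
    filter_upwards [eventually_ge_atTop 1] with T hT
    refine intervalIntegral.norm_integral_le_of_norm_le_const fun x hx => ?_
    rw [uIoc_of_le hab] at hx
    have := hdecay x ⟨hx.1.le, hx.2⟩ T (by rwa [abs_of_nonneg (by linarith)])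
    rwa [abs_of_nonneg (by linarith)] at this
  have hbot : Tendsto (fun T : ℝ => ∫ x : ℝ in a..b, f (x + (-T : ℝ) * I)) atTop (𝓝 0) := by
    refine squeeze_zero_norm' ?_ hexp
    filter_upwards [eventually_ge_atTop 1] with T hT
    refine intervalIntegral.norm_integral_le_of_norm_le_const fun x hx => ?_
    rw [uIoc_of_le hab] at hx
    have := hdecay x ⟨hx.1.le, hx.2⟩ (-T) (by rwa [abs_neg, abs_of_nonneg (by linarith)])
    rwa [abs_neg, abs_of_nonneg (by linarith)] at this
  have hlim := ((hbot.sub htop).add (hvb.const_mul I)).sub (hva.const_mul I)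
  have hconst : Tendsto (fun T : ℝ => rectInt f a b T) atTop (𝓝 (2 * Real.pi * I * r)) := by
    refine tendsto_const_nhds.congr' ?_
    filter_upwards [eventually_gt_atTop 0] with T hT using (hrect T hT).symm
  have heq := tendsto_nhds_unique hlim hconst
  have : I * ((∫ t : ℝ, f (b + t * I)) - ∫ t : ℝ, f (a + t * I)) = I * (2 * Real.pi * r) := by
    linear_combination heq
  exact mul_left_cancel₀ I_ne_zero this

/-! ### Growth of `Γ` in vertical strips. -/

/-- This is the comparison of single factors, `|τ + it| / τ ≤ |σ + it| / σ`, in Euler's product for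
`Γ`. -/
theorem norm_add_mul_I_mul_le {σ τ : ℝ} (hσ : 0 < σ) (hστ : σ ≤ τ) (t : ℝ) :
    ‖(τ : ℂ) + t * I‖ * σ ≤ ‖(σ : ℂ) + t * I‖ * τ := by
  rw [norm_add_mul_I, norm_add_mul_I]
  have h1 : √(τ ^ 2 + t ^ 2) * σ = √((τ ^ 2 + t ^ 2) * σ ^ 2) := by
    rw [Real.sqrt_mul (by positivity), Real.sqrt_sq hσ.le]
  have h2 : √(σ ^ 2 + t ^ 2) * τ = √((σ ^ 2 + t ^ 2) * τ ^ 2) := by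
    rw [Real.sqrt_mul (by positivity), Real.sqrt_sq (hσ.le.trans hστ)]
  rw [h1, h2]
  refine Real.sqrt_le_sqrt ?_
  have : σ ^ 2 ≤ τ ^ 2 := by gcongr
  nlinarith [mul_le_mul_of_nonneg_left this (sq_nonneg t)]

/-- The quotient `|Γ(σ + it)| / Γ(σ)` increases with `σ`. -/
theorem norm_Gamma_mul_Gamma_le {σ τ : ℝ} (hσ : 0 < σ) (hστ : σ ≤ τ) (t : ℝ) :
    ‖Gamma (σ + t * I)‖ * Real.Gamma τ ≤ ‖Gamma (τ + t * I)‖ * Real.Gamma σ := by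
  have hτ : 0 < τ := hσ.trans_le hστ
  refine le_of_tendsto_of_tendsto
    (((Complex.GammaSeq_tendsto_Gamma (σ + t * I)).norm).mul (Real.GammaSeq_tendsto_Gamma τ))
    (((Complex.GammaSeq_tendsto_Gamma (τ + t * I)).norm).mul (Real.GammaSeq_tendsto_Gamma σ)) ?_
  filter_upwards [eventually_gt_atTop 0] with n hn
  have hn' : (0 : ℝ) < n := by exact_mod_cast hn
  have hnorm : ∀ x : ℝ, ‖Complex.GammaSeq (x + t * I) n‖ =
      (n : ℝ) ^ x * n.factorial / ∏ j ∈ Finset.range (n + 1), ‖((x + j : ℝ) : ℂ) + t * I‖ := by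
    intro x
    have h := norm_cpow_eq_rpow_re_of_pos hn' ((x : ℂ) + t * I)
    rw [Complex.GammaSeq, norm_div, norm_mul, norm_prod, ← ofReal_natCast, h]
    simp only [add_re, ofReal_re, mul_re, I_re, mul_zero, ofReal_im, I_im, mul_one, sub_self,
      add_zero, norm_natCast]
    congr 1
    refine Finset.prod_congr rfl fun j _ => ?_
    congr 1
    push_cast
    ring
  rw [hnorm, hnorm, Real.GammaSeq, Real.GammaSeq]
  have hpos : ∀ x : ℝ, 0 < x → 0 < ∏ j ∈ Finset.range (n + 1), (x + j) := fun x hx =>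
    Finset.prod_pos fun j _ => by positivity
  have hpos' : ∀ x : ℝ, 0 < x →
      0 < ∏ j ∈ Finset.range (n + 1), ‖((x + j : ℝ) : ℂ) + t * I‖ := fun x hx =>
    Finset.prod_pos fun j _ => norm_pos_iff.mpr fun h => by
      have h1 : x + j = 0 := by simpa using congrArg re h
      have : (0 : ℝ) ≤ j := Nat.cast_nonneg j
      linarith
  rw [div_mul_div_comm, div_mul_div_comm, div_le_div_iff₀ (mul_pos (hpos' σ hσ) (hpos τ hτ))
    (mul_pos (hpos' τ hτ) (hpos σ hσ))]
  have hprod : (∏ j ∈ Finset.range (n + 1), ‖((τ + j : ℝ) : ℂ) + t * I‖) *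
      ∏ j ∈ Finset.range (n + 1), (σ + j) ≤
      (∏ j ∈ Finset.range (n + 1), ‖((σ + j : ℝ) : ℂ) + t * I‖) *
      ∏ j ∈ Finset.range (n + 1), (τ + j) := by
    rw [← Finset.prod_mul_distrib, ← Finset.prod_mul_distrib]
    refine Finset.prod_le_prod (fun j _ => by positivity) fun j _ => ?_
    exact norm_add_mul_I_mul_le (by positivity) (by linarith) t
  calc _ = ((n : ℝ) ^ σ * n.factorial * ((n : ℝ) ^ τ * n.factorial)) * _ := rfl
    _ ≤ ((n : ℝ) ^ σ * n.factorial * ((n : ℝ) ^ τ * n.factorial)) * _ :=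
        mul_le_mul_of_nonneg_left hprod (by positivity)
    _ = _ := by ring

/-- On the line `Re s = 1/2` the points `s` and `1 - s` are conjugate, so the reflection formula
gives `|Γ(s)|² = π / cosh(πt)` exactly. -/
theorem norm_Gamma_half_add_mul_I_le (t : ℝ) :
    ‖Gamma ((1 / 2 : ℝ) + t * I)‖ ≤ √(2 * Real.pi) * Real.exp (-(Real.pi * |t| / 2)) := by
  have h := Complex.Gamma_mul_Gamma_one_sub ((1 / 2 : ℝ) + t * I)
  have hconj : (1 : ℂ) - ((1 / 2 : ℝ) + t * I) = (starRingEnd ℂ) ((1 / 2 : ℝ) + t * I) := by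
    apply Complex.ext <;> simp
    norm_num
  have hsin : sin (Real.pi * ((1 / 2 : ℝ) + t * I)) = (Real.cosh (Real.pi * t) : ℝ) := by
    rw [show (Real.pi : ℂ) * ((1 / 2 : ℝ) + t * I) = ((Real.pi * t : ℝ) : ℂ) * I + Real.pi / 2 by
      push_cast; ring, Complex.sin_add_pi_div_two, Complex.cos_mul_I, Complex.ofReal_cosh]
  rw [hconj, Complex.Gamma_conj, Complex.mul_conj, hsin, Complex.normSq_eq_norm_sq] at h
  have h' : ‖Gamma ((1 / 2 : ℝ) + t * I)‖ ^ 2 = Real.pi / Real.cosh (Real.pi * t) := by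
    exact_mod_cast h
  have hcosh : Real.exp (Real.pi * |t|) / 2 ≤ Real.cosh (Real.pi * t) := by
    rw [← Real.cosh_abs, abs_mul, abs_of_pos Real.pi_pos, Real.cosh_eq]
    have := Real.exp_pos (-(Real.pi * |t|))
    linarith
  refine le_of_sq_le_sq ?_ (by positivity)
  rw [h', mul_pow, Real.sq_sqrt (by positivity), ← Real.exp_nat_mul]
  calc Real.pi / Real.cosh (Real.pi * t) ≤ Real.pi / (Real.exp (Real.pi * |t|) / 2) := by
        gcongr
    _ = 2 * Real.pi * Real.exp (-(Real.pi * |t|)) := by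
        rw [Real.exp_neg]; field_simp
    _ = _ := by congr 2; push_cast; ring

theorem exists_norm_Gamma_nat_add_half_le (N : ℕ) : ∃ A : ℝ, 0 ≤ A ∧ ∀ t : ℝ,
    ‖Gamma ((N + 1 / 2 : ℝ) + t * I)‖ ≤ A * (1 + |t|) ^ N * Real.exp (-(Real.pi * |t| / 2)) := by
  induction N with
  | zero =>
    refine ⟨√(2 * Real.pi), by positivity, fun t => ?_⟩
    simpa using norm_Gamma_half_add_mul_I_le t
  | succ N ih =>
    obtain ⟨A, hA, h⟩ := ih
    refine ⟨A * (N + 1), by positivity, fun t => ?_⟩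
    have hne : ((N + 1 / 2 : ℝ) : ℂ) + t * I ≠ 0 := fun h0 => by
      have h1 : (N + 1 / 2 : ℝ) = 0 := by simpa using congrArg re h0
      have : (0 : ℝ) ≤ N := Nat.cast_nonneg N
      linarith
    have hs : (((N + 1 : ℕ) : ℝ) + 1 / 2 : ℝ) + t * I = ((N + 1 / 2 : ℝ) : ℂ) + t * I + 1 := by
      push_cast; ring
    rw [hs, Complex.Gamma_add_one _ hne, norm_mul]
    have hle : ‖((N + 1 / 2 : ℝ) : ℂ) + t * I‖ ≤ (N + 1) * (1 + |t|) := by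
      refine (norm_add_le _ _).trans ?_
      rw [norm_mul, norm_I, mul_one, norm_real, norm_real, Real.norm_eq_abs, Real.norm_eq_abs,
        abs_of_pos (by positivity)]
      have : (0 : ℝ) ≤ N * |t| := by positivity
      nlinarith
    calc _ ≤ (N + 1) * (1 + |t|) * (A * (1 + |t|) ^ N * Real.exp (-(Real.pi * |t| / 2))) :=
          mul_le_mul hle (h t) (norm_nonneg _) (by positivity)
      _ = _ := by ring

/-- Monotonicity of `|Γ(σ + it)| / Γ(σ)` in `σ` moves the bound to one half-integer abscissa `N +
1/2 > b`, which the recurrence reduces to `1/2`. This avoids Stirling's formula. -/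
theorem exists_norm_Gamma_le {a : ℝ} (ha : 0 < a) (b : ℝ) : ∃ (A : ℝ) (N : ℕ), 0 ≤ A ∧
    ∀ σ ∈ Icc a b, ∀ t : ℝ,
      ‖Gamma (σ + t * I)‖ ≤ A * (1 + |t|) ^ N * Real.exp (-(Real.pi * |t| / 2)) := by
  obtain ⟨N, hN⟩ := exists_nat_ge b
  obtain ⟨A, hA, hAN⟩ := exists_norm_Gamma_nat_add_half_le N
  have hτ : (0 : ℝ) < N + 1 / 2 := by positivity
  have hcont : ContinuousOn Real.Gamma (Icc a b) := fun x hx =>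
    (Real.differentiableAt_Gamma fun m => by
      have : (0 : ℝ) ≤ m := Nat.cast_nonneg m
      have := hx.1
      linarith).continuousAt.continuousWithinAt
  obtain ⟨M, hM⟩ := isCompact_Icc.exists_bound_of_continuousOn hcont
  have hG := Real.Gamma_pos_of_pos hτ
  refine ⟨|M| / Real.Gamma (N + 1 / 2) * A, N, by positivity, fun σ hσ t => ?_⟩
  have h1 := norm_Gamma_mul_Gamma_le (ha.trans_le hσ.1) (τ := N + 1 / 2)
    (by linarith [hσ.2]) t
  have h2 : Real.Gamma σ ≤ |M| := ((le_abs_self _).trans (hM σ hσ)).trans (le_abs_self M)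
  rw [← le_div_iff₀ hG] at h1
  refine h1.trans ?_
  calc _ ≤ (A * (1 + |t|) ^ N * Real.exp (-(Real.pi * |t| / 2))) * |M| /
        Real.Gamma (N + 1 / 2) := by
        gcongr
        · exact (Real.Gamma_pos_of_pos (ha.trans_le hσ.1)).le
        · exact hAN t
    _ = _ := by ring

/-! ### Polynomial growth of `ζ` in vertical strips. -/

/-- `(s - 1)` times `n^{-s} - ∫ x in n..n+1, x^{-s}`, for `n = N + 1`. -/
noncomputable def zetaTail (N : ℕ) (s : ℂ) : ℂ :=
  (s - 1) * ((N + 1 : ℝ) : ℂ) ^ (-s) - ((N + 1 : ℝ) : ℂ) ^ (1 - s) + ((N + 2 : ℝ) : ℂ) ^ (1 - s)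

theorem hasDerivAt_ofReal_cpow {x : ℝ} (hx : 0 < x) (r : ℂ) :
    HasDerivAt (fun y : ℝ => (y : ℂ) ^ r) (r * (x : ℂ) ^ (r - 1)) x := by
  have h := (hasDerivAt_id (x : ℂ)).cpow_const (c := r) (Or.inl (by simpa using hx))
  have := h.comp_ofReal
  simpa using this

/-- The mean value inequality is applied twice: to `x^(-s)`, and to a function of `y` whose
increment over the interval is `zetaTail` and whose derivative is a difference of the first kind.
This gains one power of `N + 1`. -/
theorem norm_zetaTail_le (N : ℕ) {s : ℂ} (hs : 0 < s.re) :
    ‖zetaTail N s‖ ≤ ‖s - 1‖ * ‖s‖ * ((N : ℝ) + 1) ^ (-s.re - 1) := by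
  have hN : (0 : ℝ) < N + 1 := by positivity
  have hpos : ∀ x ∈ Icc (N + 1 : ℝ) (N + 2), 0 < x := fun x hx => hN.trans_le hx.1
  have h1 : ∀ x ∈ Icc (N + 1 : ℝ) (N + 2),
      ‖(x : ℂ) ^ (-s) - ((N + 1 : ℝ) : ℂ) ^ (-s)‖ ≤ ‖s‖ * ((N : ℝ) + 1) ^ (-s.re - 1) := by
    intro x hx
    have h := Convex.norm_image_sub_le_of_norm_hasDerivWithin_le
      (f := fun y : ℝ => (y : ℂ) ^ (-s)) (s := Icc (N + 1 : ℝ) (N + 2))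
      (C := ‖s‖ * ((N : ℝ) + 1) ^ (-s.re - 1))
      (fun y hy => (hasDerivAt_ofReal_cpow (hpos y hy) (-s)).hasDerivWithinAt)
      (fun y hy => ?_) (convex_Icc _ _) (left_mem_Icc.mpr (by linarith)) hx
    · refine h.trans (mul_le_of_le_one_right (by positivity) ?_)
      rw [Real.norm_eq_abs, abs_of_nonneg (by linarith [hx.1])]
      linarith [hx.2]
    · rw [norm_mul, norm_neg, norm_cpow_eq_rpow_re_of_pos (hpos y hy)]
      gcongr
      simpa using Real.rpow_le_rpow_of_nonpos hN hy.1 (show -s.re - 1 ≤ 0 by linarith)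
  have h2 := Convex.norm_image_sub_le_of_norm_hasDerivWithin_le
      (f := fun y : ℝ => (s - 1) * (((y - (N + 1) : ℝ) : ℂ) * ((N + 1 : ℝ) : ℂ) ^ (-s)) +
        (y : ℂ) ^ (1 - s))
      (f' := fun y : ℝ => (s - 1) * (1 * ((N + 1 : ℝ) : ℂ) ^ (-s)) +
        (1 - s) * (y : ℂ) ^ (1 - s - 1)) (s := Icc (N + 1 : ℝ) (N + 2))
      (C := ‖s - 1‖ * (‖s‖ * ((N : ℝ) + 1) ^ (-s.re - 1)))
      (fun y hy => ?_)
      (fun y hy => ?_) (convex_Icc _ _) (left_mem_Icc.mpr (by linarith))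
      (right_mem_Icc.mpr (by linarith))
  · have e : ‖(N + 2 : ℝ) - (N + 1)‖ = 1 := by
      rw [show (N + 2 : ℝ) - (N + 1) = 1 by ring]; simp
    rw [e, mul_one] at h2
    rw [mul_assoc]
    refine le_trans (le_of_eq ?_) h2
    congr 1
    rw [zetaTail, show (N + 2 : ℝ) - (N + 1) = 1 by ring, sub_self]
    push_cast
    ring
  · have := ((((hasDerivAt_id y).sub_const (N + 1 : ℝ)).ofReal_comp.mul_const
      (((N + 1 : ℝ) : ℂ) ^ (-s))).const_mul (s - 1)).fun_add
      (hasDerivAt_ofReal_cpow (hpos y hy) (1 - s))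
    exact (by simpa using this : HasDerivAt _ _ _).hasDerivWithinAt
  · rw [show (1 - s - 1 : ℂ) = -s by ring, show (s - 1) * (1 * ((N + 1 : ℝ) : ℂ) ^ (-s)) +
        (1 - s) * (y : ℂ) ^ (-s) = -((s - 1) * ((y : ℂ) ^ (-s) - ((N + 1 : ℝ) : ℂ) ^ (-s))) by ring,
      norm_neg, norm_mul]
    gcongr
    exact h1 y hy

theorem hasSum_zetaTail {s : ℂ} (hs : 1 < s.re) :
    HasSum (fun N => zetaTail N s) ((s - 1) * riemannZeta s - 1) := by
  have hz : HasSum (fun N : ℕ => ((N + 1 : ℝ) : ℂ) ^ (-s)) (riemannZeta s) := by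
    have hsum : Summable fun N : ℕ => 1 / ((N : ℂ) + 1) ^ s := by
      have := (summable_nat_add_iff 1).mpr (Complex.summable_one_div_nat_cpow.mpr hs)
      simpa using this
    have := hsum.hasSum
    rw [← zeta_eq_tsum_one_div_nat_add_one_cpow hs] at this
    convert this using 2 with N
    rw [cpow_neg, one_div]
    push_cast
    rfl
  have htel : HasSum (fun N : ℕ => ((N + 1 : ℝ) : ℂ) ^ (1 - s) - ((N + 2 : ℝ) : ℂ) ^ (1 - s)) 1 := by
    -- The telescoping terms are the difference of two series already known to converge absolutely.
    have hsummable : Summable fun N : ℕ =>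
        ((N + 1 : ℝ) : ℂ) ^ (1 - s) - ((N + 2 : ℝ) : ℂ) ^ (1 - s) := by
      have hb : Summable fun N : ℕ => ‖s - 1‖ * ‖s‖ * ((N : ℝ) + 1) ^ (-s.re - 1) := by
        refine Summable.mul_left _ ?_
        have := (summable_nat_add_iff 1).mpr (Real.summable_nat_rpow.mpr
          (show -s.re - 1 < -1 by linarith))
        simpa using this
      have h1 : Summable fun N => zetaTail N s :=
        Summable.of_norm_bounded hb fun N => norm_zetaTail_le N (by linarith)
      refine ((hz.summable.mul_left (s - 1)).sub h1).congr fun N => ?_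
      rw [zetaTail]; ring
    rw [hsummable.hasSum_iff_tendsto_nat]
    have hpart : ∀ n : ℕ, ∑ N ∈ Finset.range n,
        (((N + 1 : ℝ) : ℂ) ^ (1 - s) - ((N + 2 : ℝ) : ℂ) ^ (1 - s)) =
        1 - ((n + 1 : ℝ) : ℂ) ^ (1 - s) := by
      intro n
      induction n with
      | zero => simp
      | succ n ih =>
        rw [Finset.sum_range_succ, ih]
        push_cast
        rw [show (n : ℂ) + 1 + 1 = n + 2 by ring]
        ring
    simp only [hpart]
    have h0 : Tendsto (fun n : ℕ => ((n + 1 : ℝ) : ℂ) ^ (1 - s)) atTop (𝓝 0) := by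
      rw [tendsto_zero_iff_norm_tendsto_zero]
      have h1 : ∀ n : ℕ, ‖((n + 1 : ℝ) : ℂ) ^ (1 - s)‖ = (n + 1 : ℝ) ^ (-(s.re - 1)) := fun n => by
        rw [norm_cpow_eq_rpow_re_of_pos (by positivity)]
        simp
      simp only [h1]
      exact (tendsto_rpow_neg_atTop (show 0 < s.re - 1 by linarith)).comp
        (tendsto_atTop_add_const_right _ _ tendsto_natCast_atTop_atTop)
    simpa using h0.const_sub 1
  have h := (hz.mul_left (s - 1)).sub htel
  have e : (fun N => zetaTail N s) = fun N : ℕ => (s - 1) * ((N + 1 : ℝ) : ℂ) ^ (-s) -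
      (((N + 1 : ℝ) : ℂ) ^ (1 - s) - ((N + 2 : ℝ) : ℂ) ^ (1 - s)) := by
    funext N
    rw [zetaTail]
    ring
  rw [e]
  exact h

/-- The tail series still converges locally uniformly for `Re s > 1/4`, so the identity valid for
`Re s > 1` continues analytically. -/
theorem riemannZeta₁_eq_tsum {s : ℂ} (hs : 1 / 4 < s.re) :
    riemannZeta₁ s = 1 + ∑' N, zetaTail N s := by
  -- Intersecting with a ball makes the majorant of the tails uniform; this radius keeps both `s`
  -- and the base point `2` inside.
  set R : ℝ := ‖s‖ + 3
  set Ω : Set ℂ := {z | 1 / 4 < z.re} ∩ Metric.ball 0 R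
  have hΩ : IsOpen Ω := (isOpen_lt continuous_const continuous_re).inter Metric.isOpen_ball
  have hconv : Convex ℝ Ω := (convex_halfSpace_re_gt _).inter (convex_ball _ _)
  have hsum : Summable fun N : ℕ => (R + 1) * R * ((N : ℝ) + 1) ^ (-(5 / 4) : ℝ) := by
    refine Summable.mul_left _ ?_
    have := (summable_nat_add_iff 1).mpr (Real.summable_nat_rpow.mpr
      (show (-(5 / 4) : ℝ) < -1 by norm_num))
    simpa using this
  have hdiff : DifferentiableOn ℂ (fun z => 1 + ∑' N, zetaTail N z) Ω := by
    refine (differentiableOn_const _).add (differentiableOn_tsum_of_summable_norm hsum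
      (fun N z _ => ?_) hΩ fun N z hz => ?_)
    · have h1 : ((N + 1 : ℝ) : ℂ) ≠ 0 := by exact_mod_cast (show (N + 1 : ℝ) ≠ 0 by positivity)
      have h2 : ((N + 2 : ℝ) : ℂ) ≠ 0 := by exact_mod_cast (show (N + 2 : ℝ) ≠ 0 by positivity)
      refine DifferentiableAt.differentiableWithinAt ?_
      unfold zetaTail
      refine DifferentiableAt.add (DifferentiableAt.sub (DifferentiableAt.mul (by fun_prop) ?_) ?_) ?_
      · exact DifferentiableAt.const_cpow (by fun_prop) (Or.inl h1)
      · exact DifferentiableAt.const_cpow (by fun_prop) (Or.inl h1)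
      · exact DifferentiableAt.const_cpow (by fun_prop) (Or.inl h2)
    · have hz1 : 1 / 4 < z.re := hz.1
      have hz2 : ‖z‖ ≤ R := (mem_ball_zero_iff.mp hz.2).le
      refine (norm_zetaTail_le N (by linarith)).trans ?_
      have hz3 : ‖z - 1‖ ≤ R + 1 := by
        refine (norm_sub_le _ _).trans ?_
        simpa using hz2
      gcongr
      · linarith [Nat.cast_nonneg (α := ℝ) N]
      · linarith
  have h2Ω : (2 : ℂ) ∈ Ω := by
    refine ⟨by norm_num, ?_⟩
    rw [mem_ball_zero_iff]
    have := norm_nonneg s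
    simp only [R, Complex.norm_ofNat]
    linarith
  have hsΩ : s ∈ Ω := ⟨hs, by rw [mem_ball_zero_iff]; simp only [R]; linarith⟩
  refine (differentiable_riemannZeta₁.differentiableOn.analyticOnNhd hΩ).eqOn_of_preconnected_of_eventuallyEq
    (hdiff.analyticOnNhd hΩ) hconv.isPreconnected h2Ω ?_ hsΩ
  have hnhds : {z : ℂ | 1 < z.re} ∈ 𝓝 (2 : ℂ) :=
    (isOpen_lt continuous_const continuous_re).mem_nhds (by norm_num)
  filter_upwards [hnhds] with z hz
  have hz1 : z ≠ 1 := fun h => by simp [h] at hz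
  rw [(hasSum_zetaTail hz).tsum_eq, riemannZeta_eq_inv_sub_mul hz1]
  have : z - 1 ≠ 0 := sub_ne_zero.mpr hz1
  field_simp
  ring

theorem exists_norm_riemannZeta_le_of_re_ge : ∃ A : ℝ, 0 ≤ A ∧ ∀ s : ℂ, 1 / 4 < s.re → 1 ≤ |s.im| →
    ‖riemannZeta s‖ ≤ A * (1 + ‖s‖) := by
  have hsum : Summable fun N : ℕ => ((N : ℝ) + 1) ^ (-(5 / 4) : ℝ) := by
    have := (summable_nat_add_iff 1).mpr (Real.summable_nat_rpow.mpr
      (show (-(5 / 4) : ℝ) < -1 by norm_num))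
    simpa using this
  set Z := ∑' N : ℕ, ((N : ℝ) + 1) ^ (-(5 / 4) : ℝ)
  have hZ : 0 ≤ Z := tsum_nonneg fun N => by positivity
  refine ⟨1 + Z, by positivity, fun s hs ht => ?_⟩
  have hs1 : 1 ≤ ‖s - 1‖ := ht.trans (by simpa using abs_im_le_norm (s - 1))
  have hne : s ≠ 1 := fun h => by norm_num [h] at ht
  have htail : ‖∑' N, zetaTail N s‖ ≤ ‖s - 1‖ * ‖s‖ * Z := by
    refine tsum_of_norm_bounded (hsum.hasSum.mul_left (‖s - 1‖ * ‖s‖)) fun N => ?_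
    refine (norm_zetaTail_le N (by linarith)).trans ?_
    gcongr
    · linarith [Nat.cast_nonneg (α := ℝ) N]
    · linarith
  rw [riemannZeta_eq_inv_sub_mul hne, norm_mul, norm_inv, inv_mul_le_iff₀ (by linarith),
    riemannZeta₁_eq_tsum hs]
  refine (norm_add_le _ _).trans ?_
  rw [norm_one]
  nlinarith [mul_nonneg (mul_nonneg (norm_nonneg (s - 1)) (norm_nonneg s)) hZ,
    mul_nonneg (norm_nonneg (s - 1)) hZ, mul_nonneg (norm_nonneg (s - 1)) (norm_nonneg s)]

theorem norm_cos_le_exp_abs_im (z : ℂ) : ‖cos z‖ ≤ Real.exp |z.im| := by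
  rw [cos, norm_div, Complex.norm_ofNat, div_le_iff₀ two_pos]
  refine (norm_add_le _ _).trans ?_
  rw [norm_exp, norm_exp]
  have h1 : (z * I).re ≤ |z.im| := by simpa using neg_le_abs z.im
  have h2 : (-z * I).re ≤ |z.im| := by simpa using le_abs_self z.im
  linarith [Real.exp_le_exp.mpr h1, Real.exp_le_exp.mpr h2]

/-- To the right of `1/4` the tail series gives the bound. To the left the functional equation does:
the decay of `Γ` cancels the growth of the cosine exactly and leaves a power of `1 + |t|`. -/
theorem exists_norm_riemannZeta_le (a b : ℝ) : ∃ (A : ℝ) (N : ℕ), 0 ≤ A ∧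
    ∀ σ ∈ Icc a b, ∀ t : ℝ, 1 ≤ |t| → ‖riemannZeta (σ + t * I)‖ ≤ A * (1 + |t|) ^ N := by
  obtain ⟨A, hA, hζ⟩ := exists_norm_riemannZeta_le_of_re_ge
  have hright : ∀ c : ℝ, ∃ B : ℝ, 0 ≤ B ∧ ∀ σ : ℝ, 1 / 4 < σ → σ ≤ c → ∀ t : ℝ, 1 ≤ |t| →
      ‖riemannZeta (σ + t * I)‖ ≤ B * (1 + |t|) := by
    intro c
    refine ⟨A * (1 + |c|), by positivity, fun σ hσ hσc t ht => ?_⟩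
    refine (hζ _ (by simpa using hσ) (by simpa using ht)).trans ?_
    rw [mul_assoc]
    gcongr
    have h1 : ‖(σ : ℂ) + t * I‖ ≤ |σ| + |t| := by
      refine (norm_add_le _ _).trans ?_
      simp
    have h2 : |σ| ≤ |c| := by
      rw [abs_of_pos (by linarith)]
      exact hσc.trans (le_abs_self c)
    nlinarith [mul_nonneg (abs_nonneg c) (abs_nonneg t)]
  obtain ⟨B₁, hB₁, h₁⟩ := hright b
  obtain ⟨B₂, hB₂, h₂⟩ := hright (1 - a)
  obtain ⟨G, N, hG, hΓ⟩ := exists_norm_Gamma_le (show (0 : ℝ) < 1 / 4 by norm_num) (1 - a)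
  refine ⟨B₁ + 2 * G * B₂, N + 1, by positivity, fun σ hσ t ht => ?_⟩
  have ht1 : 1 ≤ 1 + |t| := by linarith [abs_nonneg t]
  rcases lt_or_ge (1 / 4) σ with h | h
  · refine (h₁ σ h hσ.2 t ht).trans ?_
    have : (1 + |t|) ≤ (1 + |t|) ^ (N + 1) := le_self_pow₀ ht1 (by simp)
    refine mul_le_mul (by linarith [mul_nonneg (mul_nonneg two_pos.le hG) hB₂]) this (by positivity)
      (by positivity)
  · set s : ℂ := ((1 - σ : ℝ) : ℂ) + ((-t : ℝ) : ℂ) * I with hs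
    have him : s.im = -t := by simp [hs]
    have hre : s.re = 1 - σ := by simp [hs]
    have ht0 : t ≠ 0 := fun h => by norm_num [h] at ht
    have hfe := riemannZeta_one_sub (s := s)
      (fun n h => ht0 (by have := congrArg im h; simpa [him] using this))
      (fun h => ht0 (by have := congrArg im h; simpa [him] using this))
    rw [show 1 - s = (σ : ℂ) + t * I by rw [hs]; push_cast; ring] at hfe
    rw [hfe, norm_mul, norm_mul, norm_mul, norm_mul]
    have e1 : ‖(2 * Real.pi : ℂ) ^ (-s)‖ ≤ 1 := by
      rw [show (2 * Real.pi : ℂ) = ((2 * Real.pi : ℝ) : ℂ) by push_cast; rfl,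
        norm_cpow_eq_rpow_re_of_pos (by positivity)]
      refine Real.rpow_le_one_of_one_le_of_nonpos (by linarith [Real.pi_gt_three]) ?_
      simp only [neg_re, hre]
      linarith
    have e2 := hΓ (1 - σ) ⟨by linarith, by linarith [hσ.1]⟩ (-t)
    rw [← hs, abs_neg] at e2
    have e3 : ‖cos (Real.pi * s / 2)‖ ≤ Real.exp (Real.pi * |t| / 2) := by
      refine (norm_cos_le_exp_abs_im _).trans_eq ?_
      congr 1
      rw [show (Real.pi : ℂ) * s / 2 = ((Real.pi / 2 : ℝ) : ℂ) * s by push_cast; ring,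
        im_ofReal_mul, him, abs_mul, abs_neg, abs_of_pos (by positivity)]
      ring
    have e4 := h₂ (1 - σ) (by linarith) (by linarith [hσ.1]) (-t) (by rwa [abs_neg])
    rw [← hs, abs_neg] at e4
    rw [Complex.norm_ofNat]
    calc 2 * ‖(2 * Real.pi : ℂ) ^ (-s)‖ * ‖Gamma s‖ * ‖cos (Real.pi * s / 2)‖ * ‖riemannZeta s‖
        ≤ 2 * 1 * (G * (1 + |t|) ^ N * Real.exp (-(Real.pi * |t| / 2))) *
          Real.exp (Real.pi * |t| / 2) * (B₂ * (1 + |t|)) := by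
          gcongr
      _ = 2 * G * B₂ * (1 + |t|) ^ (N + 1) *
          (Real.exp (-(Real.pi * |t| / 2)) * Real.exp (Real.pi * |t| / 2)) := by ring
      _ = 2 * G * B₂ * (1 + |t|) ^ (N + 1) := by rw [← Real.exp_add]; simp
      _ ≤ _ := by
        gcongr
        linarith

/-! ### The Dirichlet series of `d_k` and termwise integration. -/

theorem piltz_zero_eq (n : ℕ) : piltz 0 n = if n = 1 then 1 else 0 := by
  unfold piltz
  split_ifs with h
  · rw [h, Nat.finMulAntidiag_one, Finset.card_singleton]
  · simp [Nat.finMulAntidiag_zero_left h]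

/-- Splitting off the first factor exhibits `d_(k+1)` as the Dirichlet convolution of `1` with
`d_k`, whence the Dirichlet series `ζ^k`. -/
theorem piltz_succ (k n : ℕ) :
    piltz (k + 1) n = ∑ p ∈ n.divisorsAntidiagonal, piltz k p.2 := by
  unfold piltz
  rw [← Finset.card_sigma]
  refine Finset.card_bij' (fun f _ => ⟨(f 0, ∏ i, f (Fin.succ i)), fun i => f (Fin.succ i)⟩)
    (fun q _ => Fin.cons q.1.1 q.2) ?_ ?_ ?_ ?_
  · intro f hf
    rw [Nat.mem_finMulAntidiag, Fin.prod_univ_succ] at hf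
    have hne : ∏ i, f (Fin.succ i) ≠ 0 := fun h => hf.2 (by rw [← hf.1, h, mul_zero])
    simp [Nat.mem_finMulAntidiag, hf.1, hf.2, hne]
  · rintro ⟨⟨a, b⟩, g⟩ hq
    simp only [Finset.mem_sigma, Nat.mem_divisorsAntidiagonal, Nat.mem_finMulAntidiag] at hq
    rw [Nat.mem_finMulAntidiag, Fin.prod_univ_succ]
    simp [hq.2.1, hq.1.1, hq.1.2]
  · intro f _
    funext i
    refine Fin.cases ?_ (fun i => ?_) i <;> simp
  · rintro ⟨⟨a, b⟩, g⟩ hq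
    simp only [Finset.mem_sigma, Nat.mem_divisorsAntidiagonal, Nat.mem_finMulAntidiag] at hq
    simp [hq.2.1]

theorem LSeriesHasSum_piltz (k : ℕ) {s : ℂ} (hs : 1 < s.re) :
    LSeriesHasSum (fun n => (piltz k n : ℂ)) s (riemannZeta s ^ k) := by
  induction k with
  | zero =>
    have h : (fun n => (piltz 0 n : ℂ)) = LSeries.delta := by
      funext n
      rw [piltz_zero_eq, LSeries.delta]
      push_cast
      rfl
    rw [h, LSeriesHasSum, pow_zero, funext (LSeries.term_delta s)]
    exact hasSum_ite_eq 1 (1 : ℂ)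
  | succ k ih =>
    have h : (fun n => (piltz (k + 1) n : ℂ)) = LSeries.convolution 1 (fun n => (piltz k n : ℂ)) := by
      rw [LSeries.convolution_def]
      funext n
      rw [piltz_succ]
      push_cast
      simp
    rw [h, pow_succ, mul_comm]
    exact (LSeriesHasSum_one hs).convolution ih

theorem hasSum_piltz (k : ℕ) {s : ℂ} (hs : 1 < s.re) :
    HasSum (fun n : ℕ+ => (piltz k n : ℂ) * ((n : ℝ) : ℂ) ^ (-s)) (riemannZeta s ^ k) := by
  have h := LSeriesHasSum_piltz k hs
  rw [LSeriesHasSum, ← PNat.coe_injective.hasSum_iff] at h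
  · convert h using 2 with n
    rw [Function.comp, LSeries.term_of_ne_zero n.ne_zero, cpow_neg, div_eq_mul_inv, ofReal_natCast]
  · intro n hn
    have : n = 0 := by
      by_contra h0
      exact hn ⟨⟨n, Nat.pos_of_ne_zero h0⟩, rfl⟩
    simp [this]

theorem ofReal_cpow_eq_exp {x : ℝ} (hx : 0 < x) (s : ℂ) :
    (x : ℂ) ^ s = exp ((Real.log x : ℝ) * s) := by
  rw [cpow_def_of_ne_zero (by exact_mod_cast hx.ne'), ofReal_log hx.le]

/-- On a vertical line `|(yn)^(-w)|` does not depend on `t`, so absolute convergence at the single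
point `c` justifies exchanging sum and integral. -/
theorem hasSum_mul_integral_mul_cpow {h : ℝ → ℂ} (hh : Integrable h) {a : ℕ+ → ℂ} {c : ℝ}
    (ha : Summable fun n : ℕ+ => a n * ((n : ℝ) : ℂ) ^ (-(c : ℂ))) {S : ℝ → ℂ}
    (hS : ∀ t : ℝ, HasSum (fun n : ℕ+ => a n * ((n : ℝ) : ℂ) ^ (-((c : ℂ) + t * I))) (S t))
    {y : ℝ} (hy : 0 < y) :
    HasSum (fun n : ℕ+ => a n * ∫ t : ℝ, h t * ((y * n : ℝ) : ℂ) ^ (-((c : ℂ) + t * I)))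
      (∫ t : ℝ, h t * S t * (y : ℂ) ^ (-((c : ℂ) + t * I))) := by
  set F : ℕ+ → ℝ → ℂ := fun n t => a n * (h t * ((y * n : ℝ) : ℂ) ^ (-((c : ℂ) + t * I)))
  have hn : ∀ n : ℕ+, (0 : ℝ) < (n : ℝ) := fun n => by exact_mod_cast n.pos
  have hnorm : ∀ x : ℝ, 0 < x → ∀ t : ℝ, ‖(x : ℂ) ^ (-((c : ℂ) + t * I))‖ = x ^ (-c) := by
    intro x hx t
    rw [norm_cpow_eq_rpow_re_of_pos hx]
    simp
  have hcont : ∀ x : ℝ, 0 < x → Continuous fun t : ℝ => (x : ℂ) ^ (-((c : ℂ) + t * I)) := by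
    intro x hx
    simp only [ofReal_cpow_eq_exp hx]
    fun_prop
  have hne_int : ∀ n, Integrable (F n) := by
    intro n
    refine Integrable.const_mul ?_ _
    refine hh.mul_bdd (c := (y * n) ^ (-c)) (hcont _ (mul_pos hy (hn n))).aestronglyMeasurable
      (Eventually.of_forall fun t => (hnorm _ (mul_pos hy (hn n)) t).le)
  have hFnorm : ∀ n t, ‖F n t‖ = ‖a n * ((n : ℝ) : ℂ) ^ (-(c : ℂ))‖ * y ^ (-c) * ‖h t‖ := by
    intro n t
    have h0 := hnorm n (hn n) 0
    simp only [ofReal_zero, zero_mul, add_zero] at h0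
    simp only [F, norm_mul]
    rw [hnorm _ (mul_pos hy (hn n)), h0, Real.mul_rpow hy.le (hn n).le]
    ring
  have hsum : Summable fun n => ∫ t, ‖F n t‖ := by
    simp only [hFnorm, integral_const_mul]
    exact (ha.norm.mul_right _).mul_right _
  have key := hasSum_integral_of_summable_integral_norm hne_int hsum
  simp only [F, integral_const_mul] at key
  have e : ∫ t : ℝ, h t * S t * (y : ℂ) ^ (-((c : ℂ) + t * I)) =
      ∫ t : ℝ, ∑' n : ℕ+, a n * (h t * ((y * n : ℝ) : ℂ) ^ (-((c : ℂ) + t * I))) := by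
    refine integral_congr_ae (Eventually.of_forall fun t => ?_)
    have := ((hS t).mul_left (h t * (y : ℂ) ^ (-((c : ℂ) + t * I)))).tsum_eq
    simp only
    rw [mul_right_comm, ← this]
    refine tsum_congr fun n => ?_
    rw [ofReal_mul, mul_cpow_ofReal_nonneg hy.le (hn n).le]
    ring
  rw [e]
  exact key

theorem exists_one_add_abs_pow_mul_exp_le (N : ℕ) : ∃ A : ℝ, 0 ≤ A ∧ ∀ t : ℝ,
    (1 + |t|) ^ N * Real.exp (-(Real.pi * |t| / 2)) ≤ A * Real.exp (-|t|) := by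
  refine ⟨N.factorial * 2 ^ N * Real.exp (1 / 2), by positivity, fun t => ?_⟩
  have h := Real.pow_div_factorial_le_exp ((1 + |t|) / 2) (by positivity) N
  rw [div_le_iff₀ (by positivity), div_pow, div_le_iff₀ (by positivity)] at h
  -- Of the rate `3/2 < π/2`, one half absorbs the polynomial and the remaining `1` is the claimed
  -- decay.
  have h3 : Real.exp (-(Real.pi * |t| / 2)) ≤ Real.exp (-(3 / 2 * |t|)) := by
    refine Real.exp_le_exp.mpr ?_
    nlinarith [Real.pi_gt_three, abs_nonneg t]
  calc _ ≤ (Real.exp ((1 + |t|) / 2) * N.factorial * 2 ^ N) * Real.exp (-(3 / 2 * |t|)) := by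
        gcongr
    _ = N.factorial * 2 ^ N * (Real.exp ((1 + |t|) / 2) * Real.exp (-(3 / 2 * |t|))) := by ring
    _ = N.factorial * 2 ^ N * (Real.exp (1 / 2) * Real.exp (-|t|)) := by
        rw [← Real.exp_add, ← Real.exp_add]
        congr 2
        ring
    _ = _ := by ring

/-! ### The Meijer function as an inverse Mellin transform. -/

/-- The Mellin transform `Γ(w)^k cos(πw/2)^{k-1}` of the (normalized) Meijer function. -/
noncomputable def mellinKernel (k : ℕ) (w : ℂ) : ℂ :=
  Gamma w ^ k * cos (Real.pi * w / 2) ^ (k - 1)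

theorem differentiableAt_mellinKernel (k : ℕ) {w : ℂ} (hw : 0 < w.re) :
    DifferentiableAt ℂ (mellinKernel k) w := by
  have h : DifferentiableAt ℂ Gamma w := differentiableAt_Gamma w fun m h => by
    rw [h] at hw
    simp only [neg_re, natCast_re] at hw
    linarith [Nat.cast_nonneg (α := ℝ) m]
  unfold mellinKernel
  fun_prop

theorem abs_im_pi_mul_div_two (σ t : ℝ) :
    |((Real.pi : ℂ) * (σ + t * I) / 2).im| = Real.pi * |t| / 2 := by
  rw [show (Real.pi : ℂ) * (σ + t * I) / 2 = ((Real.pi / 2 : ℝ) : ℂ) * (σ + t * I) by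
    push_cast; ring, im_ofReal_mul, abs_mul, abs_of_pos (by positivity)]
  simp
  ring

/-- There are `k` Gamma factors of size `exp(-π|t|/2)` against `k - 1` cosines of size
`exp(π|t|/2)`, so one decaying factor survives. -/
theorem exists_norm_mellinKernel_le {k : ℕ} (hk : 1 ≤ k) {a : ℝ} (ha : 0 < a) (b : ℝ) :
    ∃ A : ℝ, 0 ≤ A ∧ ∀ σ ∈ Icc a b, ∀ t : ℝ,
      ‖mellinKernel k (σ + t * I)‖ ≤ A * Real.exp (-|t|) := by
  obtain ⟨G, N, hG, hΓ⟩ := exists_norm_Gamma_le ha b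
  obtain ⟨B, hB, hexp⟩ := exists_one_add_abs_pow_mul_exp_le (N * k)
  refine ⟨G ^ k * B, by positivity, fun σ hσ t => ?_⟩
  have hc := norm_cos_le_exp_abs_im (Real.pi * (σ + t * I) / 2)
  rw [abs_im_pi_mul_div_two] at hc
  obtain ⟨K, rfl⟩ : ∃ K, k = K + 1 := ⟨k - 1, by omega⟩
  rw [mellinKernel, norm_mul, norm_pow, norm_pow, Nat.add_sub_cancel]
  set E := Real.exp (-(Real.pi * |t| / 2)) with hE
  have hE1 : E * Real.exp (Real.pi * |t| / 2) = 1 := by rw [hE, ← Real.exp_add]; simp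
  calc _ ≤ (G * (1 + |t|) ^ N * E) ^ (K + 1) * Real.exp (Real.pi * |t| / 2) ^ K := by
        gcongr
        exact hΓ σ hσ t
    _ = G ^ (K + 1) * ((1 + |t|) ^ (N * (K + 1)) * E) * (E * Real.exp (Real.pi * |t| / 2)) ^ K := by
        rw [pow_mul]; ring
    _ = G ^ (K + 1) * ((1 + |t|) ^ (N * (K + 1)) * E) := by rw [hE1]; ring
    _ ≤ G ^ (K + 1) * (B * Real.exp (-|t|)) :=
        mul_le_mul_of_nonneg_left (hexp t) (by positivity)
    _ = _ := by ring

theorem continuous_mellinKernel_line (k : ℕ) {c : ℝ} (hc : 0 < c) :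
    Continuous fun t : ℝ => mellinKernel k (c + t * I) :=
  continuous_iff_continuousAt.mpr fun t =>
    ContinuousAt.comp (f := fun t : ℝ => (c : ℂ) + t * I)
      (differentiableAt_mellinKernel k (by simpa using hc)).continuousAt (by fun_prop)

theorem integrable_mellinKernel {k : ℕ} (hk : 1 ≤ k) {c : ℝ} (hc : 0 < c) :
    Integrable fun t : ℝ => mellinKernel k (c + t * I) := by
  obtain ⟨A, _, h⟩ := exists_norm_mellinKernel_le hk hc c
  exact integrable_of_continuous_of_decay (continuous_mellinKernel_line k hc)
    fun t _ => h c ⟨le_rfl, le_rfl⟩ t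

theorem norm_ofReal_cpow_neg_line {x : ℝ} (hx : 0 < x) (c t : ℝ) :
    ‖(x : ℂ) ^ (-((c : ℂ) + t * I))‖ = x ^ (-c) := by
  rw [norm_cpow_eq_rpow_re_of_pos hx]
  simp

theorem continuous_ofReal_cpow_neg_line {x : ℝ} (hx : 0 < x) (c : ℝ) :
    Continuous fun t : ℝ => (x : ℂ) ^ (-((c : ℂ) + t * I)) := by
  simp only [ofReal_cpow_eq_exp hx]
  fun_prop

theorem integrable_mul_ofReal_cpow {h : ℝ → ℂ} (hh : Integrable h) {x : ℝ} (hx : 0 < x) (c : ℝ) :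
    Integrable fun t : ℝ => h t * (x : ℂ) ^ (-((c : ℂ) + t * I)) :=
  hh.mul_bdd (c := x ^ (-c)) (continuous_ofReal_cpow_neg_line hx c).aestronglyMeasurable
    (Eventually.of_forall fun t => (norm_ofReal_cpow_neg_line hx c t).le)

/-- The kernel has no poles in `Re w > 0`. This independence of the line makes the choice of `C < 0`
immaterial and later allows the line to lie far to the right. -/
theorem integral_mellinKernel_eq_of_le {k : ℕ} (hk : 1 ≤ k) {c d : ℝ} (hc : 0 < c) (hcd : c ≤ d)
    {y : ℝ} (hy : 0 < y) :
    ∫ t : ℝ, mellinKernel k (d + t * I) * (y : ℂ) ^ (-((d : ℂ) + t * I)) =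
      ∫ t : ℝ, mellinKernel k (c + t * I) * (y : ℂ) ^ (-((c : ℂ) + t * I)) := by
  obtain ⟨A, hA, h⟩ := exists_norm_mellinKernel_le hk hc d
  obtain ⟨M, hM⟩ := isCompact_Icc.exists_bound_of_continuousOn
    (f := fun σ : ℝ => y ^ (-σ)) (s := Icc c d)
    ((Real.continuous_const_rpow hy.ne').comp continuous_neg).continuousOn
  have key := integral_vertical_sub (f := fun w => mellinKernel k w * (y : ℂ) ^ (-w))
    (A := A * M) (r := 0) hcd (fun T hT => ?_)
    (integrable_mul_ofReal_cpow (integrable_mellinKernel hk hc) hy c)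
    (integrable_mul_ofReal_cpow (integrable_mellinKernel hk (hc.trans_le hcd)) hy d) ?_
  · rwa [mul_zero, sub_eq_zero] at key
  · rw [mul_zero]
    refine rectInt_eq_zero hcd hT.le fun w hw => DifferentiableAt.differentiableWithinAt ?_
    have hw' : 0 < w.re := hc.trans_le hw.1.1
    exact (differentiableAt_mellinKernel k hw').mul
      (DifferentiableAt.const_cpow (by fun_prop) (Or.inl (by exact_mod_cast hy.ne')))
  · intro σ hσ t _
    rw [norm_mul, norm_ofReal_cpow_neg_line hy]
    have h1 := hM σ hσ
    rw [Real.norm_of_nonneg (by positivity)] at h1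
    calc _ ≤ A * Real.exp (-|t|) * M := by
          gcongr
          exact h σ hσ t
      _ = _ := by ring

theorem integral_mellinKernel_eq {k : ℕ} (hk : 1 ≤ k) {c d : ℝ} (hc : 0 < c) (hd : 0 < d)
    {y : ℝ} (hy : 0 < y) :
    ∫ t : ℝ, mellinKernel k (d + t * I) * (y : ℂ) ^ (-((d : ℂ) + t * I)) =
      ∫ t : ℝ, mellinKernel k (c + t * I) * (y : ℂ) ^ (-((c : ℂ) + t * I)) := by
  rcases le_total c d with h | h
  · exact integral_mellinKernel_eq_of_le hk hc h hy
  · exact (integral_mellinKernel_eq_of_le hk hd h hy).symm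

theorem inv_Gamma_half_sub {w : ℂ} (hw : 0 < w.re) :
    (Gamma (1 / 2 - w / 2))⁻¹ = Gamma (w / 2 + 1 / 2) * cos (Real.pi * w / 2) / Real.pi := by
  have h := Complex.Gamma_mul_Gamma_one_sub (w / 2 + 1 / 2)
  have hsin : sin (Real.pi * (w / 2 + 1 / 2)) = cos (Real.pi * w / 2) := by
    rw [← Complex.sin_add_pi_div_two]
    congr 1
    ring
  rw [hsin, show (1 : ℂ) - (w / 2 + 1 / 2) = 1 / 2 - w / 2 by ring] at h
  have hne : Gamma (w / 2 + 1 / 2) ≠ 0 := Gamma_ne_zero_of_re_pos (by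
    simp only [add_re, div_ofNat_re, one_re]
    linarith)
  have hpi : (Real.pi : ℂ) ≠ 0 := by exact_mod_cast Real.pi_ne_zero
  by_cases hcos : cos (Real.pi * w / 2) = 0
  -- Here `Γ(1/2 - w/2)` has a pole. Its value in Lean is `0`, and so is the inverse, in agreement
  -- with the entire function `1/Γ`.
  · rw [hcos, div_zero] at h
    rw [(mul_eq_zero.mp h).resolve_left hne, hcos]
    simp
  · have hG : Gamma (1 / 2 - w / 2) ≠ 0 := fun h0 => by
      rw [h0, mul_zero] at h
      exact div_ne_zero hpi hcos h.symm
    rw [eq_div_iff hcos] at h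
    rw [inv_eq_iff_eq_inv, eq_comm, inv_eq_iff_eq_inv, eq_comm, inv_eq_one_div, div_eq_div_iff hG hpi]
    linear_combination -h

/-- Reflection moves the `k - 1` lower Gamma factors upstairs, giving `k` pairs `Γ(w/2) Γ(w/2 +
1/2)` for the duplication formula. The resulting `2^(-kw)` cancels against the `2^(2k)` in the
argument. -/
theorem meijerGIntegrand_eq {k : ℕ} (hk : 1 ≤ k) {w : ℂ} (hw : 0 < w.re) {y : ℝ} (hy : 0 < y) :
    meijerGIntegrand [] [] (lowerLeft k) (lowerRight k) ((y ^ 2 / 2 ^ (2 * k) : ℝ) : ℂ) (-(w / 2)) =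
      2 ^ k * ((√Real.pi : ℝ) : ℂ) ^ k / (Real.pi : ℂ) ^ (k - 1) *
        (mellinKernel k w * (y : ℂ) ^ (-w)) := by
  have h1 : meijerGIntegrand [] [] (lowerLeft k) (lowerRight k) ((y ^ 2 / 2 ^ (2 * k) : ℝ) : ℂ)
      (-(w / 2)) = Gamma (w / 2) ^ k * Gamma (w / 2 + 1 / 2) * (Gamma (1 / 2 - w / 2))⁻¹ ^ (k - 1) *
        ((y ^ 2 / 2 ^ (2 * k) : ℝ) : ℂ) ^ (-(w / 2)) := by
    have e1 : (1 / 2 : ℂ) - -(w / 2) = w / 2 + 1 / 2 := by ring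
    have e2 : (1 : ℂ) - 1 / 2 + -(w / 2) = 1 / 2 - w / 2 := by ring
    simp only [meijerGIntegrand, lowerLeft, lowerRight, List.map_append, List.map_replicate,
      List.prod_append, List.prod_replicate, List.map_cons, List.map_nil, List.prod_cons,
      List.prod_nil, e1, e2, zero_sub, neg_neg, mul_one]
    rw [inv_pow, ← div_eq_mul_inv]
  have h2 : ((y ^ 2 / 2 ^ (2 * k) : ℝ) : ℂ) ^ (-(w / 2)) = (y : ℂ) ^ (-w) * ((2 : ℂ) ^ w) ^ k := by
    have h2' : (2 : ℂ) ^ w = exp ((Real.log 2 : ℝ) * w) := by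
      rw [← ofReal_cpow_eq_exp two_pos]; norm_num
    rw [ofReal_cpow_eq_exp (by positivity), ofReal_cpow_eq_exp hy, h2', ← Complex.exp_nat_mul,
      ← Complex.exp_add, Real.log_div (by positivity) (by positivity), Real.log_pow, Real.log_pow]
    congr 1
    push_cast
    ring
  have h3 := Complex.Gamma_mul_Gamma_add_half (w / 2)
  rw [show 2 * (w / 2) = w by ring, cpow_sub _ _ two_ne_zero, cpow_one] at h3
  have h2w : (2 : ℂ) ^ w ≠ 0 := by simp [cpow_eq_zero_iff]
  have hpi : (Real.pi : ℂ) ≠ 0 := by exact_mod_cast Real.pi_ne_zero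
  obtain ⟨K, rfl⟩ : ∃ K, k = K + 1 := ⟨k - 1, by omega⟩
  rw [h1, h2, inv_Gamma_half_sub hw, mellinKernel, Nat.add_sub_cancel]
  set c := cos (Real.pi * w / 2)
  calc _ = (Gamma (w / 2) * Gamma (w / 2 + 1 / 2)) ^ (K + 1) * (c / Real.pi) ^ K *
        ((y : ℂ) ^ (-w) * ((2 : ℂ) ^ w) ^ (K + 1)) := by
        rw [mul_pow, div_pow, div_pow, mul_pow]
        ring
    _ = _ := by
        rw [h3]
        simp only [mul_pow, div_pow]
        field_simp

theorem meijerGIntegrand_line_eq {k : ℕ} (hk : 1 ≤ k) {C : ℝ} (hC : C < 0) {y : ℝ} (hy : 0 < y)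
    (t : ℝ) :
    meijerGIntegrand [] [] (lowerLeft k) (lowerRight k) ((y ^ 2 / 2 ^ (2 * k) : ℝ) : ℂ)
        ((C : ℂ) + (t : ℂ) * I) =
      2 ^ k * ((√Real.pi : ℝ) : ℂ) ^ k / (Real.pi : ℂ) ^ (k - 1) *
        (mellinKernel k ((-2 * C : ℝ) + (-2 * t : ℝ) * I) *
          (y : ℂ) ^ (-(((-2 * C : ℝ) : ℂ) + (-2 * t : ℝ) * I))) := by
  rw [← meijerGIntegrand_eq hk (by simpa using by linarith) hy]
  congr 1
  push_cast
  ring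

theorem integrable_meijerGIntegrand {k : ℕ} (hk : 1 ≤ k) {C : ℝ} (hC : C < 0) {z : ℝ} (hz : 0 < z) :
    Integrable fun t : ℝ => meijerGIntegrand [] [] (lowerLeft k) (lowerRight k) (z : ℂ)
      ((C : ℂ) + (t : ℂ) * I) := by
  have hy : 0 < √z * 2 ^ k := by positivity
  have e : z = (√z * 2 ^ k) ^ 2 / 2 ^ (2 * k) := by
    rw [mul_pow, Real.sq_sqrt hz.le, ← pow_mul, mul_comm k 2]
    field_simp
  rw [e]
  simp only [meijerGIntegrand_line_eq hk hC hy]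
  refine Integrable.const_mul ?_ _
  exact (integrable_mul_ofReal_cpow (integrable_mellinKernel hk
    (show 0 < -2 * C by linarith)) hy (-2 * C)).comp_mul_left' (by norm_num : (-2 : ℝ) ≠ 0)

theorem meijerG_eq {k : ℕ} (hk : 1 ≤ k) {C c : ℝ} (hC : C < 0) (hc : 0 < c) {y : ℝ} (hy : 0 < y) :
    meijerG C [] [] (lowerLeft k) (lowerRight k) ((y ^ 2 / 2 ^ (2 * k) : ℝ) : ℂ) =
      2 ^ (k - 1) * ((√Real.pi : ℝ) : ℂ) ^ k / (Real.pi : ℂ) ^ (k - 1) * (1 / (2 * Real.pi)) *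
        ∫ t : ℝ, mellinKernel k (c + t * I) * (y : ℂ) ^ (-((c : ℂ) + t * I)) := by
  have hpi : (Real.pi : ℂ) ≠ 0 := by exact_mod_cast Real.pi_ne_zero
  rw [meijerG, integral_mul_const]
  simp only [meijerGIntegrand_line_eq hk hC hy]
  rw [integral_const_mul]
  -- The substitution `w = -2s` carries `Re s = C` to `Re w = -2C` and contributes the factor `1/2`.
  have hsub := Measure.integral_comp_mul_left (fun t : ℝ => mellinKernel k ((-2 * C : ℝ) + t * I) *
    (y : ℂ) ^ (-(((-2 * C : ℝ) : ℂ) + t * I))) (-2)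
  rw [hsub, integral_mellinKernel_eq hk hc (show 0 < -2 * C by linarith) hy]
  obtain ⟨K, rfl⟩ : ∃ K, k = K + 1 := ⟨k - 1, by omega⟩
  rw [show |(-2 : ℝ)⁻¹| = 1 / 2 by norm_num [abs_of_neg], Complex.real_smul]
  have hI := I_ne_zero
  simp only [Nat.add_sub_cancel]
  push_cast
  field_simp
  ring

/-! ### `Ψ` and the main series as line integrals. -/

theorem hasSum_psiTerm {k : ℕ} (hk : 1 ≤ k) {C c : ℝ} (hC : C < 0) (hc : 1 < c) {ρ x : ℝ}
    (hρ : 0 < ρ) (hx : 0 < x) :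
    HasSum (fun j : ℕ+ => psiTerm C ρ k x j)
      (2 ^ (k - 1) * ((√Real.pi : ℝ) : ℂ) ^ k / (Real.pi : ℂ) ^ (k - 1) * (1 / (2 * Real.pi)) *
        ∫ t : ℝ, mellinKernel k (c + t * I) * riemannZeta (c + t * I) ^ k *
          ((ρ * x : ℝ) : ℂ) ^ (-((c : ℂ) + t * I))) := by
  have hc0 : 0 < c := by linarith
  have h := (hasSum_mul_integral_mul_cpow (integrable_mellinKernel hk hc0)
    (a := fun n => (piltz k n : ℂ)) (c := c) (S := fun t => riemannZeta (c + t * I) ^ k)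
    (hasSum_piltz k (s := c) (by simpa using hc)).summable
    (fun t => hasSum_piltz k (by simpa using hc)) (mul_pos hρ hx)).mul_left
    (2 ^ (k - 1) * ((√Real.pi : ℝ) : ℂ) ^ k / (Real.pi : ℂ) ^ (k - 1) * (1 / (2 * Real.pi)))
  refine h.congr_fun fun j => ?_
  have hj : (0 : ℝ) < (j : ℝ) := by exact_mod_cast j.pos
  rw [psiTerm, show ρ ^ 2 * ((j : ℕ) : ℝ) ^ 2 * x ^ 2 / 2 ^ (2 * k) =
    (ρ * x * j) ^ 2 / 2 ^ (2 * k) by ring, meijerG_eq hk hC hc0 (by positivity)]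
  ring

theorem pi_cpow_half_sub_one (k : ℕ) :
    (Real.pi : ℂ) ^ ((k : ℂ) / 2 - 1) = ((√Real.pi : ℝ) : ℂ) ^ k / Real.pi := by
  have hpi : (Real.pi : ℂ) ≠ 0 := by exact_mod_cast Real.pi_ne_zero
  rw [cpow_sub _ _ hpi, cpow_one]
  congr 1
  have h : ((√Real.pi : ℝ) : ℂ) = (Real.pi : ℂ) ^ (1 / 2 : ℂ) := by
    rw [Real.sqrt_eq_rpow, ofReal_cpow Real.pi_pos.le]
    norm_num
  rw [h, ← cpow_nat_mul]
  congr 1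
  ring

theorem Psi_eq {k : ℕ} (hk : 1 ≤ k) {C c : ℝ} (hC : C < 0) (hc : 1 < c) {ρ x : ℝ}
    (hρ : 0 < ρ) (hx : 0 < x) :
    Psi C ρ k x = 1 / (2 * Real.pi) *
      ∫ t : ℝ, mellinKernel k (c + t * I) * riemannZeta (c + t * I) ^ k *
          ((ρ * x : ℝ) : ℂ) ^ (-((c : ℂ) + t * I)) := by
  have hpi : (Real.pi : ℂ) ≠ 0 := by exact_mod_cast Real.pi_ne_zero
  obtain ⟨K, rfl⟩ : ∃ K, k = K + 1 := ⟨k - 1, by omega⟩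
  have hsq : ((√Real.pi : ℝ) : ℂ) ^ (K + 1) * ((√Real.pi : ℝ) : ℂ) ^ (K + 1) =
      (Real.pi : ℂ) ^ (K + 1) := by
    rw [← mul_pow, ← ofReal_mul, Real.mul_self_sqrt Real.pi_pos.le]
  rw [Psi, (hasSum_psiTerm hk hC hc hρ hx).tsum_eq, pi_cpow_half_sub_one, Nat.add_sub_cancel]
  have h2 : (2 : ℂ) ^ K ≠ 0 := pow_ne_zero _ two_ne_zero
  generalize (∫ t : ℝ, mellinKernel (K + 1) (c + t * I) * riemannZeta (c + t * I) ^ (K + 1) *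
          ((ρ * x : ℝ) : ℂ) ^ (-((c : ℂ) + t * I))) = J
  calc _ = (((√Real.pi : ℝ) : ℂ) ^ (K + 1) * ((√Real.pi : ℝ) : ℂ) ^ (K + 1)) /
        (Real.pi * (Real.pi : ℂ) ^ K) * (2 ^ K / 2 ^ K) * (1 / (2 * Real.pi) * J) := by
        field_simp
    _ = _ := by
        rw [hsq, div_self h2, ← pow_succ', div_self (pow_ne_zero _ hpi)]
        ring

theorem integrable_mellinKernel_mul_zeta {k : ℕ} (hk : 1 ≤ k) {c : ℝ} (hc : 1 < c) :
    Integrable fun t : ℝ => mellinKernel k (c + t * I) * riemannZeta (c + t * I) ^ k := by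
  have hcont : Continuous fun t : ℝ => riemannZeta (c + t * I) ^ k := by
    refine Continuous.pow (continuous_iff_continuousAt.mpr fun t =>
      ContinuousAt.comp (f := fun t : ℝ => (c : ℂ) + t * I)
      (differentiableAt_riemannZeta fun h => ?_).continuousAt (by fun_prop)) k
    have := congrArg re h
    simp at this
    linarith
  have hsum := (hasSum_piltz k (s := c) (by simpa using hc)).summable.norm
  refine (integrable_mellinKernel hk (by linarith)).mul_bdd
    (c := ∑' n : ℕ+, ‖(piltz k n : ℂ) * ((n : ℝ) : ℂ) ^ (-(c : ℂ))‖) hcont.aestronglyMeasurable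
    (Eventually.of_forall fun t => ?_)
  rw [← (hasSum_piltz k (s := c + t * I) (by simpa using hc)).tsum_eq]
  refine tsum_of_norm_bounded hsum.hasSum fun n => le_of_eq ?_
  have hn : (0 : ℝ) < (n : ℝ) := by exact_mod_cast n.pos
  rw [norm_mul, norm_mul, norm_ofReal_cpow_neg_line hn, norm_cpow_eq_rpow_re_of_pos hn]
  simp

/-- The two conditions on `c` place both `w` and `2m + 1 + w` in the half-plane where the Dirichlet
series converge absolutely. -/
theorem hasSum_mainTerm {k : ℕ} (hk : 1 ≤ k) {C c : ℝ} (hC : C < 0) (hc : 1 < c) {m : ℤ}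
    (hcm : 0 < c + 2 * m) {γ : ℝ} (hγ : 0 < γ) :
    HasSum (fun n : ℕ+ => mainTerm C m k γ n)
      (1 / (2 * Real.pi) * ∫ t : ℝ, mellinKernel k (c + t * I) * riemannZeta (c + t * I) ^ k *
        riemannZeta (2 * m + 1 + (c + t * I)) ^ k *
          (((2 * γ) ^ k : ℝ) : ℂ) ^ (-((c : ℂ) + t * I))) := by
  have hS : ∀ s : ℂ, s.re = c → HasSum (fun n : ℕ+ =>
      (piltz k n : ℂ) / (n : ℂ) ^ (2 * m + 1) * ((n : ℝ) : ℂ) ^ (-s))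
      (riemannZeta (2 * m + 1 + s) ^ k) := by
    intro s hs
    refine (hasSum_piltz k (s := 2 * m + 1 + s) ?_).congr_fun fun n => ?_
    · simp only [add_re, mul_re, re_ofNat, intCast_re, im_ofNat, intCast_im, one_re, hs]
      linarith
    · have hn : (n : ℂ) ≠ 0 := by exact_mod_cast n.ne_zero
      rw [ofReal_natCast, neg_add, cpow_add _ _ hn, cpow_neg _ (2 * (m : ℂ) + 1),
        show (2 * (m : ℂ) + 1) = ((2 * m + 1 : ℤ) : ℂ) by push_cast; ring, cpow_intCast]
      ring
  have h := (hasSum_mul_integral_mul_cpow (integrable_mellinKernel_mul_zeta hk hc)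
    (a := fun n => (piltz k n : ℂ) / (n : ℂ) ^ (2 * m + 1)) (c := c)
    (S := fun t => riemannZeta (2 * m + 1 + (c + t * I)) ^ k)
    (hS c (by simp)).summable (fun t => hS _ (by simp))
    (show 0 < (2 * γ) ^ k by positivity)).mul_left (1 / (2 * Real.pi : ℂ))
  refine h.congr_fun fun n => ?_
  have hn : (0 : ℝ) < (n : ℝ) := by exact_mod_cast n.pos
  rw [mainTerm, Psi_eq hk hC hc (by positivity) hn]
  ring

/-! ### The symmetric kernel: functional equation, reflection and decay. -/

theorem exp_abs_im_le_norm_cos {z : ℂ} (hz : 1 ≤ |z.im|) : Real.exp |z.im| ≤ 4 * ‖cos z‖ := by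
  have h2 : Real.exp (-|z.im|) ≤ Real.exp |z.im| / 2 := by
    have h1 : (2 : ℝ) ≤ Real.exp (|z.im| + |z.im|) := by
      have := Real.add_one_le_exp (|z.im| + |z.im|)
      linarith
    rw [Real.exp_add] at h1
    rw [Real.exp_neg, inv_le_iff_one_le_mul₀ (Real.exp_pos _)]
    linarith
  have h3 : ‖exp (z * I) + exp (-z * I)‖ = 2 * ‖cos z‖ := by
    rw [cos, norm_div, Complex.norm_ofNat]
    ring
  have e1 : ‖exp (z * I)‖ = Real.exp (-z.im) := by rw [norm_exp]; simp
  have e2 : ‖exp (-z * I)‖ = Real.exp z.im := by rw [norm_exp]; simp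
  rcases abs_cases z.im with ⟨h, _⟩ | ⟨h, _⟩
  · have := norm_sub_le (exp (z * I) + exp (-z * I)) (exp (z * I))
    rw [add_sub_cancel_left, h3, e1, e2] at this
    rw [h] at h2 ⊢
    linarith
  · have := norm_sub_le (exp (z * I) + exp (-z * I)) (exp (-z * I))
    rw [add_sub_cancel_right, h3, e1, e2] at this
    rw [h] at h2 ⊢
    rw [neg_neg] at h2
    linarith

/-- The integrand of the transformation formula, in the form that shows its symmetry under
`w ↦ -2m - w`. -/
noncomputable def symmKernel (m : ℤ) (k : ℕ) (γ : ℝ) (w : ℂ) : ℂ :=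
  (1 / 2) ^ k * riemannZeta (1 - w) ^ k * riemannZeta (2 * m + 1 + w) ^ k *
    ((Real.pi / γ : ℝ) : ℂ) ^ ((k : ℂ) * w) / cos (Real.pi * w / 2)

/-- The functional equation absorbs `Γ^k cos^k ζ(w)^k` into `ζ(1-w)^k`. Only `k - 1` cosines are
present, so one remains in the denominator. -/
theorem mellinKernel_mul_eq_symmKernel {k : ℕ} (hk : 1 ≤ k) (m : ℤ) {γ : ℝ} (hγ : 0 < γ) {w : ℂ}
    (hw : ∀ n : ℕ, w ≠ -n) (hw1 : w ≠ 1) (hcos : cos (Real.pi * w / 2) ≠ 0) :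
    mellinKernel k w * riemannZeta w ^ k * riemannZeta (2 * m + 1 + w) ^ k *
      (((2 * γ) ^ k : ℝ) : ℂ) ^ (-w) = symmKernel m k γ w := by
  have hpow : (((2 * γ) ^ k : ℝ) : ℂ) ^ (-w) =
      ((2 * Real.pi : ℂ) ^ (-w)) ^ k * ((Real.pi / γ : ℝ) : ℂ) ^ ((k : ℂ) * w) := by
    rw [show (2 * Real.pi : ℂ) = ((2 * Real.pi : ℝ) : ℂ) by push_cast; rfl,
      ofReal_cpow_eq_exp (by positivity), ofReal_cpow_eq_exp (by positivity),
      ofReal_cpow_eq_exp (by positivity), ← Complex.exp_nat_mul, ← Complex.exp_add, Real.log_pow,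
      Real.log_mul two_ne_zero hγ.ne', Real.log_mul two_ne_zero Real.pi_ne_zero,
      Real.log_div Real.pi_ne_zero hγ.ne']
    congr 1
    push_cast
    ring
  rw [symmKernel, riemannZeta_one_sub hw hw1, hpow, mellinKernel, eq_div_iff hcos]
  obtain ⟨K, rfl⟩ : ∃ K, k = K + 1 := ⟨k - 1, by omega⟩
  rw [Nat.add_sub_cancel]
  have h2 : (1 / 2 : ℂ) ^ (K + 1) * 2 ^ (K + 1) = 1 := by
    rw [← mul_pow]; norm_num
  simp only [mul_pow]
  linear_combination (-((2 * Real.pi : ℂ) ^ (-w)) ^ (K + 1) * Gamma w ^ (K + 1) *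
    cos (Real.pi * w / 2) ^ (K + 1) * riemannZeta w ^ (K + 1) *
    riemannZeta (2 * m + 1 + w) ^ (K + 1) *
    ((Real.pi / γ : ℝ) : ℂ) ^ (((K + 1 : ℕ) : ℂ) * w)) * h2

theorem cos_int_mul_pi_eq (m : ℤ) : cos (m * Real.pi) = (-1) ^ m := by
  have h := congrArg ((↑) : ℝ → ℂ) (Real.cos_int_mul_pi m)
  push_cast at h
  exact h

theorem symmKernel_reflect (k : ℕ) (m : ℤ) {α β : ℝ} (hα : 0 < α) (hβ : 0 < β)
    (hαβ : α * β = Real.pi ^ 2) (w : ℂ) :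
    ((α : ℂ) ^ k) ^ (-m) * symmKernel m k α (-2 * m - w) =
      (-(β : ℂ) ^ k) ^ (-m) * symmKernel m k β w := by
  have hcos : cos (Real.pi * (-2 * m - w) / 2) = (-1) ^ m * cos (Real.pi * w / 2) := by
    rw [← Complex.cos_neg, show -((Real.pi : ℂ) * (-2 * m - w) / 2) =
      Real.pi * w / 2 + m * Real.pi by ring, Complex.cos_add, Complex.sin_int_mul_pi,
      cos_int_mul_pi_eq]
    ring
  have hz : ∀ x : ℝ, 0 < x → ((x : ℂ) ^ k) ^ (-m) = exp ((Real.log x : ℝ) * (k * (-m))) := by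
    intro x hx
    rw [← ofReal_cpow_eq_exp hx, ← zpow_natCast, ← zpow_mul, ← cpow_intCast]
    push_cast
    rfl
  have hneg : (-(β : ℂ) ^ k) ^ (-m) = (-1) ^ m * ((β : ℂ) ^ k) ^ (-m) := by
    rw [neg_eq_neg_one_mul, mul_zpow, zpow_neg, ← inv_zpow]
    norm_num
  have hlog : Real.log α + Real.log β = 2 * Real.log Real.pi := by
    rw [← Real.log_mul hα.ne' hβ.ne', hαβ, Real.log_pow]
    norm_num
  have hpow : ((α : ℂ) ^ k) ^ (-m) * ((Real.pi / α : ℝ) : ℂ) ^ ((k : ℂ) * (-2 * m - w)) =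
      ((β : ℂ) ^ k) ^ (-m) * ((Real.pi / β : ℝ) : ℂ) ^ ((k : ℂ) * w) := by
    rw [hz α hα, hz β hβ, ofReal_cpow_eq_exp (by positivity), ofReal_cpow_eq_exp (by positivity),
      ← Complex.exp_add, ← Complex.exp_add, Real.log_div Real.pi_ne_zero hα.ne',
      Real.log_div Real.pi_ne_zero hβ.ne']
    congr 1
    have : (Real.log β : ℂ) = 2 * Real.log Real.pi - Real.log α := by
      rw [eq_sub_iff_add_eq, add_comm]
      exact_mod_cast hlog
    push_cast
    rw [this]
    ring
  have hm1 : ((-1 : ℂ) ^ m) * (-1) ^ m = 1 := by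
    rw [← mul_zpow]; norm_num
  have hm0 : ((-1 : ℂ) ^ m) ≠ 0 := left_ne_zero_of_mul_eq_one hm1
  have hinv : ((-1 : ℂ) ^ m)⁻¹ = (-1) ^ m := (eq_inv_of_mul_eq_one_left hm1).symm
  rw [symmKernel, symmKernel, hcos, hneg, show (1 : ℂ) - (-2 * m - w) = 2 * m + 1 + w by ring,
    show (2 * (m : ℂ) + 1 + (-2 * m - w)) = 1 - w by ring, div_eq_mul_inv, mul_inv, hinv,
    div_eq_mul_inv]
  linear_combination ((1 / 2) ^ k * riemannZeta (1 - w) ^ k * riemannZeta (2 * m + 1 + w) ^ k *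
    (-1) ^ m * (cos (Real.pi * w / 2))⁻¹) * hpow

theorem cos_pi_mul_div_two_ne_zero {w : ℂ} (hw : ∀ j : ℤ, w ≠ (2 * j + 1 : ℤ)) :
    cos (Real.pi * w / 2) ≠ 0 := by
  rw [Ne, Complex.cos_eq_zero_iff]
  rintro ⟨j, hj⟩
  refine hw j ?_
  have hpi : (Real.pi : ℂ) ≠ 0 := by exact_mod_cast Real.pi_ne_zero
  have : (Real.pi : ℂ) * w = Real.pi * (2 * j + 1) := by linear_combination 2 * hj
  push_cast
  exact mul_left_cancel₀ hpi this

theorem differentiableAt_symmKernel_num (m : ℤ) (k : ℕ) {γ : ℝ} (hγ : 0 < γ) {w : ℂ}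
    (h0 : w ≠ 0) (hm : w ≠ -2 * m) :
    DifferentiableAt ℂ (fun w => (1 / 2) ^ k * riemannZeta (1 - w) ^ k *
      riemannZeta (2 * m + 1 + w) ^ k * ((Real.pi / γ : ℝ) : ℂ) ^ ((k : ℂ) * w)) w := by
  have h1 : DifferentiableAt ℂ (fun w => riemannZeta (1 - w)) w :=
    DifferentiableAt.comp (g := riemannZeta) w
      (differentiableAt_riemannZeta fun h => h0 (by linear_combination -h)) (by fun_prop)
  have h2 : DifferentiableAt ℂ (fun w => riemannZeta (2 * m + 1 + w)) w :=
    DifferentiableAt.comp (g := riemannZeta) w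
      (differentiableAt_riemannZeta fun h => hm (by linear_combination h)) (by fun_prop)
  have h3 : DifferentiableAt ℂ (fun w => ((Real.pi / γ : ℝ) : ℂ) ^ ((k : ℂ) * w)) w :=
    DifferentiableAt.const_cpow (by fun_prop)
      (Or.inl (by exact_mod_cast (div_pos Real.pi_pos hγ).ne'))
  exact (((differentiableAt_const _).mul (h1.pow k)).mul (h2.pow k)).mul h3

theorem differentiableAt_symmKernel (m : ℤ) (k : ℕ) {γ : ℝ} (hγ : 0 < γ) {w : ℂ}
    (h0 : w ≠ 0) (hm : w ≠ -2 * m) (hw : ∀ j : ℤ, w ≠ (2 * j + 1 : ℤ)) :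
    DifferentiableAt ℂ (symmKernel m k γ) w :=
  (differentiableAt_symmKernel_num m k hγ h0 hm).div (by fun_prop) (cos_pi_mul_div_two_ne_zero hw)

theorem exists_norm_symmKernel_le (m : ℤ) (k : ℕ) {γ : ℝ} (hγ : 0 < γ) (a b : ℝ) :
    ∃ A : ℝ, ∀ σ ∈ Icc a b, ∀ t : ℝ, 1 ≤ |t| →
      ‖symmKernel m k γ (σ + t * I)‖ ≤ A * Real.exp (-|t|) := by
  obtain ⟨A₁, N₁, hA₁, h₁⟩ := exists_norm_riemannZeta_le (1 - b) (1 - a)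
  obtain ⟨A₂, N₂, hA₂, h₂⟩ := exists_norm_riemannZeta_le (2 * m + 1 + a) (2 * m + 1 + b)
  obtain ⟨M, hM⟩ := isCompact_Icc.exists_bound_of_continuousOn
    (f := fun σ : ℝ => (Real.pi / γ) ^ (k * σ)) (s := Icc a b)
    ((Real.continuous_const_rpow (div_pos Real.pi_pos hγ).ne').comp
      (continuous_const.mul continuous_id)).continuousOn
  obtain ⟨B, hB, hexp⟩ := exists_one_add_abs_pow_mul_exp_le (N₁ * k + N₂ * k)
  refine ⟨A₁ ^ k * A₂ ^ k * |M| * 4 * B, fun σ hσ t ht => ?_⟩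
  have e1 := h₁ (1 - σ) ⟨by linarith [hσ.2], by linarith [hσ.1]⟩ (-t) (by rwa [abs_neg])
  rw [abs_neg, show (((1 - σ : ℝ) : ℂ) + (-t : ℝ) * I) = 1 - (σ + t * I) by push_cast; ring] at e1
  have e2 := h₂ (2 * m + 1 + σ) ⟨by linarith [hσ.1], by linarith [hσ.2]⟩ t ht
  rw [show (((2 * m + 1 + σ : ℝ) : ℂ) + t * I) = 2 * m + 1 + (σ + t * I) by push_cast; ring] at e2
  have e3 : ‖((Real.pi / γ : ℝ) : ℂ) ^ ((k : ℂ) * (σ + t * I))‖ ≤ |M| := by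
    rw [norm_cpow_eq_rpow_re_of_pos (div_pos Real.pi_pos hγ)]
    have := hM σ hσ
    rw [Real.norm_of_nonneg (by positivity)] at this
    refine le_trans (le_of_eq ?_) (this.trans (le_abs_self M))
    congr 1
    simp
  have e4 := exp_abs_im_le_norm_cos (z := Real.pi * (σ + t * I) / 2) (by
    rw [abs_im_pi_mul_div_two]; nlinarith [Real.pi_gt_three])
  rw [abs_im_pi_mul_div_two] at e4
  have hcpos : 0 < ‖cos (Real.pi * (σ + t * I) / 2)‖ := by
    have := Real.exp_pos (Real.pi * |t| / 2)
    linarith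
  have e5 : ‖cos (Real.pi * (σ + t * I) / 2)‖⁻¹ ≤ 4 * Real.exp (-(Real.pi * |t| / 2)) := by
    rw [Real.exp_neg, inv_le_iff_one_le_mul₀ hcpos]
    have := Real.exp_pos (Real.pi * |t| / 2)
    field_simp
    linarith
  have e6 : ‖(1 / 2 : ℂ) ^ k‖ ≤ 1 := by
    rw [norm_pow]
    exact pow_le_one₀ (norm_nonneg _) (by norm_num)
  rw [norm_pow] at e6
  simp only [symmKernel, div_eq_mul_inv _ (cos _), norm_mul, norm_inv, norm_pow]
  have hM0 := abs_nonneg M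
  calc _ ≤ 1 * (A₁ * (1 + |t|) ^ N₁) ^ k * (A₂ * (1 + |t|) ^ N₂) ^ k * |M| *
        (4 * Real.exp (-(Real.pi * |t| / 2))) := by gcongr
    _ = A₁ ^ k * A₂ ^ k * |M| * 4 *
        ((1 + |t|) ^ (N₁ * k + N₂ * k) * Real.exp (-(Real.pi * |t| / 2))) := by
        rw [pow_add, pow_mul, pow_mul]; ring
    _ ≤ A₁ ^ k * A₂ ^ k * |M| * 4 * (B * Real.exp (-|t|)) :=
        mul_le_mul_of_nonneg_left (hexp t) (by positivity)
    _ = _ := by ring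

theorem integrable_symmKernel (m : ℤ) (k : ℕ) {γ : ℝ} (hγ : 0 < γ) {c : ℝ} (hc : ∀ j : ℤ, c ≠ j) :
    Integrable fun t : ℝ => symmKernel m k γ (c + t * I) := by
  obtain ⟨A, h⟩ := exists_norm_symmKernel_le m k hγ c c
  have hne : ∀ (j : ℤ) (t : ℝ), (c : ℂ) + t * I ≠ j := fun j t h =>
    hc j (by simpa using congrArg re h)
  refine integrable_of_continuous_of_decay (A := A) (continuous_iff_continuousAt.mpr fun t =>
    ContinuousAt.comp (f := fun t : ℝ => (c : ℂ) + t * I) (DifferentiableAt.continuousAt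
      (differentiableAt_symmKernel m k hγ ?_ ?_ fun j => hne _ t)) (by fun_prop))
    fun t ht => h c ⟨le_rfl, le_rfl⟩ t ht
  · simpa using hne 0 t
  · simpa using hne (-2 * m) t

/-! ### Residues of the symmetric kernel, one unit strip at a time. -/

/-- The integral of the symmetric kernel along the vertical line through `c`. -/
noncomputable def lineInt (m : ℤ) (k : ℕ) (γ c : ℝ) : ℂ :=
  ∫ t : ℝ, symmKernel m k γ (c + t * I)

theorem lineInt_reflect (k : ℕ) (m : ℤ) {α β : ℝ} (hα : 0 < α) (hβ : 0 < β)
    (hαβ : α * β = Real.pi ^ 2) (c : ℝ) :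
    ((α : ℂ) ^ k) ^ (-m) * lineInt m k α (-2 * m - c) =
      (-(β : ℂ) ^ k) ^ (-m) * lineInt m k β c := by
  unfold lineInt
  rw [← integral_neg_eq_self, ← integral_const_mul, ← integral_const_mul]
  congr 1
  funext t
  rw [← symmKernel_reflect k m hα hβ hαβ]
  congr 2
  push_cast
  ring

/-- The poles lie at integers, so lines at half-integers isolate them. The width `3/4` gives an open
strip that contains the closed one of half-width `1/2` but no other integer. -/
theorem lineInt_add_half_sub (m : ℤ) (k : ℕ) {γ : ℝ} (hγ : 0 < γ) (p : ℤ) (n : ℕ) {g : ℂ → ℂ}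
    (hg : ∀ w : ℂ, |w.re - p| < 3 / 4 → DifferentiableAt ℂ g w)
    (hfg : ∀ w : ℂ, |w.re - p| < 3 / 4 → w ≠ p →
      symmKernel m k γ w = g w / (w - p) ^ (n + 1)) :
    lineInt m k γ (p + 1 / 2) - lineInt m k γ (p - 1 / 2) =
      2 * Real.pi * (iteratedDeriv n g p / n.factorial) := by
  obtain ⟨A, hA⟩ := exists_norm_symmKernel_le m k hγ (p - 1 / 2) (p + 1 / 2)
  have hhalf : ∀ i j : ℤ, (i : ℝ) + 1 / 2 ≠ j := fun i j h => by
    have h2 : (2 * i + 1 : ℝ) = 2 * j := by linarith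
    have : (2 * i + 1 : ℤ) = 2 * j := by exact_mod_cast h2
    omega
  have hU : IsOpen {w : ℂ | |w.re - p| < 3 / 4} :=
    isOpen_lt (by fun_prop) continuous_const
  have hsub : ∀ T : ℝ, Icc ((p : ℝ) - 1 / 2) (p + 1 / 2) ×ℂ Icc (-T) T ⊆
      {w : ℂ | |w.re - p| < 3 / 4} := by
    intro T w hw
    have := hw.1
    simp only [mem_preimage, mem_Icc] at this
    rw [mem_ofPred_eq, abs_lt]
    constructor <;> linarith
  refine integral_vertical_sub (by linarith) (fun T hT => ?_)
    (integrable_symmKernel m k hγ fun j h => hhalf (p - 1) j (by push_cast; linarith))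
    (integrable_symmKernel m k hγ (hhalf p)) hA
  have h := rectInt_div_sub_pow (a := p - 1 / 2) (b := p + 1 / 2) (p := p) (by linarith)
    (by linarith) hT hU (hsub T) (fun w hw => (hg w hw).differentiableWithinAt) n
  rw [ofReal_intCast] at h
  rw [← h]
  refine rectInt_congr (p := p) (by linarith) (by linarith) hT fun w hw => ?_
  exact hfg w (hsub T hw.1) (by simpa using hw.2)

theorem lineInt_sub_of_regular (m : ℤ) (k : ℕ) {γ : ℝ} (hγ : 0 < γ) {p : ℤ} (hp : Even p)
    (hp0 : p ≠ 0) (hpm : p ≠ -2 * m) :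
    lineInt m k γ (p + 1 / 2) - lineInt m k γ (p - 1 / 2) = 0 := by
  have hne_int : ∀ (w : ℂ) (j : ℤ), |w.re - p| < 3 / 4 → w = j → j = p := by
    intro w j hw h
    rw [h, intCast_re, abs_lt] at hw
    have h1 : (j : ℝ) < p + 1 := by linarith
    have h2 : (p : ℝ) < j + 1 := by linarith
    have h1' : j < p + 1 := by exact_mod_cast h1
    have h2' : p < j + 1 := by exact_mod_cast h2
    omega
  -- Without a singularity at `p`, the kernel is written artificially over `w - p`, with a numerator
  -- vanishing at `p`.
  rw [lineInt_add_half_sub m k hγ p 0 (g := fun w => (w - p) * symmKernel m k γ w)]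
  · simp
  · intro w hw
    refine DifferentiableAt.mul (by fun_prop) (differentiableAt_symmKernel m k hγ ?_ ?_ ?_)
    · exact fun h => hp0 (hne_int w 0 hw (by simpa using h)).symm
    · exact fun h => hpm (hne_int w (-2 * m) hw (by simpa using h)).symm
    · intro j h
      have := hne_int w _ hw h
      rw [← this] at hp
      exact (Int.not_even_iff_odd.mpr ⟨j, rfl⟩) hp
  · intro w _ hne
    have : w - p ≠ 0 := sub_ne_zero.mpr hne
    field_simp
    simp

theorem hasDerivAt_cos_pi_mul_div_two (w : ℂ) :
    HasDerivAt (fun w : ℂ => cos (Real.pi * w / 2)) (-sin (Real.pi * w / 2) * (Real.pi / 2)) w := by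
  have h : HasDerivAt (fun w : ℂ => (Real.pi : ℂ) * w / 2) (Real.pi / 2) w := by
    simpa using ((hasDerivAt_id w).const_mul (Real.pi : ℂ)).div_const 2
  exact h.ccos

theorem sin_pi_mul_odd_div_two (l : ℤ) : sin (Real.pi * ((2 * l + 1 : ℤ) : ℂ) / 2) = (-1) ^ l := by
  rw [show (Real.pi : ℂ) * ((2 * l + 1 : ℤ) : ℂ) / 2 = l * Real.pi + Real.pi / 2 by
    push_cast; ring, Complex.sin_add_pi_div_two, cos_int_mul_pi_eq]

/-- The cosine has a simple zero at `p`, and `dslope` divides it out. The zeta poles `0` and `-2m`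
are even, so the numerator is regular in the strip. -/
theorem lineInt_sub_of_odd (m : ℤ) (k : ℕ) {γ : ℝ} (hγ : 0 < γ) (l : ℤ) :
    lineInt m k γ ((2 * l + 1 : ℤ) + 1 / 2) - lineInt m k γ ((2 * l + 1 : ℤ) - 1 / 2) =
      2 * Real.pi * ((1 / 2) ^ k * riemannZeta (1 - (2 * l + 1 : ℤ)) ^ k *
        riemannZeta (2 * m + 1 + (2 * l + 1 : ℤ)) ^ k *
        ((Real.pi / γ : ℝ) : ℂ) ^ ((k : ℂ) * (2 * l + 1 : ℤ)) / (-(-1) ^ l * (Real.pi / 2))) := by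
  set p : ℤ := 2 * l + 1 with hp
  have hne_int : ∀ (w : ℂ) (j : ℤ), |w.re - p| < 3 / 4 → w = j → j = p := by
    intro w j hw h
    rw [h, intCast_re, abs_lt] at hw
    have h1 : (j : ℝ) < p + 1 := by linarith
    have h2 : (p : ℝ) < j + 1 := by linarith
    have h1' : j < p + 1 := by exact_mod_cast h1
    have h2' : p < j + 1 := by exact_mod_cast h2
    omega
  have hpi : (Real.pi : ℂ) ≠ 0 := by exact_mod_cast Real.pi_ne_zero
  set c : ℂ → ℂ := fun w => cos (Real.pi * w / 2) with hc
  have hcp : c p = 0 := by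
    rw [hc]
    simp only
    rw [Complex.cos_eq_zero_iff]
    exact ⟨l, by rw [hp]; push_cast; ring⟩
  have hderiv : deriv c p = -(-1) ^ l * (Real.pi / 2) := by
    rw [(hasDerivAt_cos_pi_mul_div_two p).deriv, hp, sin_pi_mul_odd_div_two]
  have hslope : ∀ w, (w - p) * dslope c p w = c w := fun w => by
    have := sub_smul_dslope c (p : ℂ) w
    rwa [smul_eq_mul, hcp, sub_zero] at this
  have hcdiff : Differentiable ℂ c := fun w => (hasDerivAt_cos_pi_mul_div_two w).differentiableAt
  have hsdiff : ∀ w, DifferentiableAt ℂ (dslope c p) w := fun w =>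
    ((Complex.differentiableOn_dslope univ_mem).mpr hcdiff.differentiableOn).differentiableAt
      univ_mem
  have hsne : ∀ w : ℂ, |w.re - p| < 3 / 4 → dslope c p w ≠ 0 := by
    intro w hw h0
    by_cases hwp : w = p
    · rw [hwp, dslope_same, hderiv] at h0
      have : ((-1 : ℂ) ^ l) ≠ 0 := zpow_ne_zero _ (by norm_num)
      exact mul_ne_zero (neg_ne_zero.mpr this) (div_ne_zero hpi two_ne_zero) h0
    · have h1 := hslope w
      rw [h0, mul_zero] at h1
      refine cos_pi_mul_div_two_ne_zero (w := w) (fun j hj => hwp ?_) h1.symm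
      rw [hj, hne_int w _ hw hj]
  rw [lineInt_add_half_sub m k hγ p 0 (g := fun w => ((1 / 2) ^ k * riemannZeta (1 - w) ^ k *
      riemannZeta (2 * m + 1 + w) ^ k * ((Real.pi / γ : ℝ) : ℂ) ^ ((k : ℂ) * w)) / dslope c p w)]
  · rw [iteratedDeriv_zero, dslope_same, hderiv, Nat.factorial_zero, Nat.cast_one, div_one]
  · intro w hw
    refine (differentiableAt_symmKernel_num m k hγ ?_ ?_).div (hsdiff w) (hsne w hw)
    · intro h
      have := hne_int w 0 hw (by simpa using h)
      omega
    · intro h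
      have := hne_int w (-2 * m) hw (by simpa using h)
      omega
  · intro w _ _
    rw [symmKernel, show cos (Real.pi * w / 2) = c w from rfl, ← hslope w, zero_add, pow_one,
      div_div, mul_comm (w - _)]

/-- By `Γ(w+1) = w Γ(w)`, the kernel times `w^k` is `zetaProduct`. As `m ≠ 0`, the other zeta pole
`-2m` lies outside the strip. -/
theorem lineInt_sub_zero {m : ℤ} (hm : m ≠ 0) {k : ℕ} (hk : 1 ≤ k) {γ : ℝ} (hγ : 0 < γ) :
    lineInt m k γ (1 / 2) - lineInt m k γ (-1 / 2) =
      2 * Real.pi * (1 / ((k - 1).factorial : ℂ) * iteratedDeriv (k - 1) (zetaProduct m k γ) 0) := by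
  have h := lineInt_add_half_sub m k hγ 0 (k - 1) (g := zetaProduct m k γ) ?_ ?_
  · rw [Int.cast_zero, Int.cast_zero, zero_add, zero_sub, ← neg_div] at h
    rw [h]
    ring
  · intro w hw
    rw [Int.cast_zero, sub_zero, abs_lt] at hw
    have h1 : DifferentiableAt ℂ (fun w => riemannZeta (2 * m + 1 + w)) w := by
      refine DifferentiableAt.comp (g := riemannZeta) w
        (differentiableAt_riemannZeta fun h => ?_) (by fun_prop)
      have h2 : w = ((-2 * m : ℤ) : ℂ) := by push_cast; linear_combination h
      rw [h2, intCast_re] at hw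
      have h3 : (-2 * m : ℤ) < 1 := by
        have : ((-2 * m : ℤ) : ℝ) < 1 := by linarith
        exact_mod_cast this
      have h4 : (-1 : ℤ) < -2 * m := by
        have : (-1 : ℝ) < ((-2 * m : ℤ) : ℝ) := by linarith
        exact_mod_cast this
      omega
    have h2 : DifferentiableAt ℂ riemannZeta w := differentiableAt_riemannZeta fun h => by
      rw [h, one_re] at hw
      linarith
    have h3 : DifferentiableAt ℂ (fun w => Gamma (w + 1)) w := by
      refine DifferentiableAt.comp (g := Gamma) w (differentiableAt_Gamma _ fun n h => ?_)
        (by fun_prop)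
      have := congrArg re h
      simp only [add_re, one_re, neg_re, natCast_re] at this
      linarith [Nat.cast_nonneg (α := ℝ) n]
    have h4 : DifferentiableAt ℂ (fun w : ℂ => ((2 * γ : ℝ) : ℂ) ^ (-(k : ℂ) * w)) w :=
      DifferentiableAt.const_cpow (by fun_prop)
        (Or.inl (by exact_mod_cast (mul_pos two_pos hγ).ne'))
    have h5 : DifferentiableAt ℂ (fun w : ℂ => cos (Real.pi * w / 2)) w := by fun_prop
    exact ((((h1.pow k).mul (h2.pow k)).mul (h3.pow k)).mul (h5.pow (k - 1))).mul h4
  · intro w hw hne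
    rw [Int.cast_zero] at hne
    rw [Int.cast_zero, sub_zero, abs_lt] at hw
    have hwn : ∀ n : ℕ, w ≠ -n := by
      intro n h
      rcases Nat.eq_zero_or_pos n with h0 | h0
      · exact hne (by rw [h, h0]; simp)
      · rw [h, neg_re, natCast_re] at hw
        have : (1 : ℝ) ≤ n := by exact_mod_cast h0
        linarith
    have hw1 : w ≠ 1 := fun h => by
      rw [h, one_re] at hw
      linarith
    have hcos : cos (Real.pi * w / 2) ≠ 0 := by
      refine cos_pi_mul_div_two_ne_zero fun j h => ?_
      rw [h, intCast_re] at hw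
      have h3 : (2 * j + 1 : ℤ) < 1 := by
        have : ((2 * j + 1 : ℤ) : ℝ) < 1 := by linarith
        exact_mod_cast this
      have h4 : (-1 : ℤ) < 2 * j + 1 := by
        have : (-1 : ℝ) < ((2 * j + 1 : ℤ) : ℝ) := by linarith
        exact_mod_cast this
      omega
    have hpow : (((2 * γ) ^ k : ℝ) : ℂ) ^ (-w) = ((2 * γ : ℝ) : ℂ) ^ (-(k : ℂ) * w) := by
      rw [ofReal_cpow_eq_exp (by positivity), ofReal_cpow_eq_exp (by positivity), Real.log_pow]
      congr 1
      push_cast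
      ring
    rw [← mellinKernel_mul_eq_symmKernel hk m hγ hwn hw1 hcos, zetaProduct, mellinKernel,
      Complex.Gamma_add_one w hne, Int.cast_zero, sub_zero, Nat.sub_add_cancel hk, hpow,
      eq_div_iff (pow_ne_zero _ hne), mul_pow]
    ring

theorem lineInt_sub_eq_sum (m : ℤ) (k : ℕ) (γ : ℝ) (a : ℤ) (n : ℕ) :
    lineInt m k γ ((a + n : ℤ) + 1 / 2) - lineInt m k γ (a - 1 / 2) =
      ∑ p ∈ Finset.Icc a (a + n),
        (lineInt m k γ ((p : ℝ) + 1 / 2) - lineInt m k γ ((p : ℝ) - 1 / 2)) := by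
  induction n with
  | zero => simp
  | succ n ih =>
    have hI : Finset.Icc a (a + (n + 1 : ℕ)) =
        insert (a + (n + 1 : ℕ)) (Finset.Icc a (a + (n : ℕ))) := by
      ext x
      simp only [Finset.mem_Icc, Finset.mem_insert]
      push_cast
      omega
    rw [hI, Finset.sum_insert (by simp), ← ih]
    push_cast
    rw [show (a : ℝ) + (n + 1) - 1 / 2 = a + n + 1 / 2 by ring]
    ring

theorem riemannZeta_neg_even {q : ℤ} (hq : q < 0) : riemannZeta ((2 * q : ℤ) : ℂ) = 0 := by
  obtain ⟨n, hn⟩ : ∃ n : ℕ, q = -(n + 1 : ℤ) := ⟨(-q - 1).toNat, by omega⟩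
  rw [hn]
  have := riemannZeta_neg_two_mul_nat_add_one n
  convert this using 2
  push_cast
  ring

/-- The sum of the contributions of all poles. -/
theorem lineInt_sub_eq_residues {m : ℤ} (hm : m ≠ 0) {k : ℕ} (hk : 1 ≤ k) {γ : ℝ} (hγ : 0 < γ)
    {N : ℕ} (hN : 2 * |m| + 1 ≤ N) :
    lineInt m k γ (N + 1 / 2) - lineInt m k γ (-2 * m - (N + 1 / 2)) =
      (lineInt m k γ (1 / 2) - lineInt m k γ (-1 / 2)) +
      (lineInt m k γ (-2 * m + 1 / 2) - lineInt m k γ (-2 * m - 1 / 2)) +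
      ∑ j ∈ Finset.Icc (0 : ℤ) (m + 1),
        (lineInt m k γ ((2 * (j - m - 1) + 1 : ℤ) + 1 / 2) -
          lineInt m k γ ((2 * (j - m - 1) + 1 : ℤ) - 1 / 2)) := by
  have hm1 : m ≤ |m| := le_abs_self m
  have hm2 : -m ≤ |m| := neg_le_abs m
  obtain ⟨n, hn⟩ : ∃ n : ℕ, (N : ℤ) = (-2 * m - N) + n := ⟨(2 * m + 2 * N).toNat, by omega⟩
  have hsum := lineInt_sub_eq_sum m k γ (-2 * m - N) n
  rw [← hn] at hsum
  set step : ℤ → ℂ := fun p =>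
    lineInt m k γ ((p : ℝ) + 1 / 2) - lineInt m k γ ((p : ℝ) - 1 / 2) with hstep
  set T₂ : Finset ℤ := (Finset.Icc (0 : ℤ) (m + 1)).image fun j => 2 * (j - m - 1) + 1
  have hdisj : Disjoint ({0, -2 * m} : Finset ℤ) T₂ := by
    rw [Finset.disjoint_left]
    intro p hp hp2
    simp only [Finset.mem_insert, Finset.mem_singleton] at hp
    obtain ⟨j, _, hj⟩ := Finset.mem_image.mp hp2
    omega
  have hsub : ({0, -2 * m} : Finset ℤ) ∪ T₂ ⊆ Finset.Icc (-2 * m - N) N := by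
    intro p hp
    rw [Finset.mem_union, Finset.mem_image] at hp
    simp only [Finset.mem_insert, Finset.mem_singleton, Finset.mem_Icc] at hp ⊢
    rcases hp with hp | ⟨j, hj, hj2⟩ <;> omega
  have hzero : ∀ p ∈ Finset.Icc (-2 * m - (N : ℤ)) N, p ∉ ({0, -2 * m} : Finset ℤ) ∪ T₂ →
      step p = 0 := by
    intro p _ hp
    rw [Finset.mem_union, Finset.mem_image] at hp
    simp only [Finset.mem_insert, Finset.mem_singleton, Finset.mem_Icc, not_or, not_exists,
      not_and] at hp
    obtain ⟨⟨hp0, hpm⟩, hpT⟩ := hp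
    rcases Int.even_or_odd p with he | ⟨l, hl⟩
    · exact lineInt_sub_of_regular m k hγ he hp0 hpm
    · have hl' := hpT (l + m + 1)
      rw [hstep, hl]
      simp only
      rw [lineInt_sub_of_odd m k hγ l]
      by_cases hneg : l + m + 1 < 0
      · have e : (2 * (m : ℂ) + 1 + ((2 * l + 1 : ℤ) : ℂ)) = ((2 * (l + m + 1) : ℤ) : ℂ) := by
          push_cast; ring
        rw [e, riemannZeta_neg_even hneg, zero_pow (by omega)]
        simp
      · have e : ((1 : ℂ) - ((2 * l + 1 : ℤ) : ℂ)) = ((2 * (-l) : ℤ) : ℂ) := by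
          push_cast; ring
        rw [e, riemannZeta_neg_even (by omega), zero_pow (by omega)]
        simp
  rw [← Finset.sum_subset hsub hzero, Finset.sum_union hdisj, Finset.sum_pair (by omega),
    Finset.sum_image (by intro a _ b _ h; simpa using h)] at hsum
  simp only [hstep] at hsum
  push_cast at hsum ⊢
  rw [show -2 * (m : ℝ) - (N + 1 / 2) = -2 * m - N - 1 / 2 by ring, hsum]
  simp only [zero_add, zero_sub, neg_div]

/-! ### Bernoulli numbers and the assembly of the formula. -/

/-- The case `n = 0`, where both sides are `-1/2`, is needed for the end terms of the finite sum. -/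
theorem riemannZeta_two_mul_nat_eq (n : ℕ) :
    riemannZeta (2 * n) = -(-1) ^ n * (2 ^ n * Real.pi ^ n) ^ 2 / 2 *
      (bernoulli (2 * n) : ℂ) / ((2 * n).factorial : ℂ) := by
  rw [riemannZeta_two_mul_nat', zpow_sub₀ two_ne_zero, zpow_one,
    show (2 * (n : ℤ)) = ((2 * n : ℕ) : ℤ) by push_cast; rfl, zpow_natCast]
  ring

/-- At the pole `1 - 2l` the zeta arguments are `2l` and `2j` with `j + l = m + 1`. Euler's formula
and `β = π²/α` reduce the claim to matching powers of `2`, `π`, `α` and signs. -/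
theorem residue_term_eq {k : ℕ} (hk : 1 ≤ k) {α β : ℝ} (hα : 0 < α)
    (hαβ : α * β = Real.pi ^ 2) (j l : ℕ) {m : ℤ} (hm : m = j + l - 1) :
    ((α : ℂ) ^ k) ^ (-m) * ((1 / 2) ^ k * riemannZeta (2 * l) ^ k * riemannZeta (2 * j) ^ k *
        ((Real.pi / α : ℝ) : ℂ) ^ ((k : ℂ) * (1 - 2 * l)) / (-(-1) ^ l * (Real.pi / 2))) =
      (-1 : ℂ) ^ ((k : ℤ) * m + k + m) * ((Real.pi : ℂ) / 2) ^ (k - 1) *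
        (2 : ℂ) ^ (2 * (k : ℤ) * m) * ((-1 : ℂ) ^ j *
          ((bernoulli (2 * l) : ℂ) ^ k * (bernoulli (2 * j) : ℂ) ^ k) /
            (((2 * l).factorial : ℂ) ^ k * ((2 * j).factorial : ℂ) ^ k) *
            ((α : ℂ) ^ l) ^ k * ((β : ℂ) ^ j) ^ k) := by
  have hpi : (Real.pi : ℂ) ≠ 0 := by exact_mod_cast Real.pi_ne_zero
  have hα0 : (α : ℂ) ≠ 0 := by exact_mod_cast hα.ne'
  have hβ : (β : ℂ) = Real.pi ^ 2 / α := by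
    rw [eq_div_iff hα0, mul_comm]
    exact_mod_cast hαβ
  have h1 : ((α : ℂ) ^ k) ^ (-m) = α ^ k / ((α ^ j) ^ k * (α ^ l) ^ k) := by
    rw [hm, show (-((j : ℤ) + l - 1)) = 1 - ((j + l : ℕ) : ℤ) by push_cast; ring,
      zpow_sub₀ (pow_ne_zero _ hα0), zpow_one, zpow_natCast, ← mul_pow, ← pow_add, ← pow_mul,
      ← pow_mul, mul_comm k]
  have h2 : ((Real.pi / α : ℝ) : ℂ) ^ ((k : ℂ) * (1 - 2 * l)) =
      (Real.pi / α) ^ k / (((Real.pi / α) ^ l) ^ k) ^ 2 := by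
    have hq : (Real.pi / α : ℂ) ≠ 0 := div_ne_zero hpi hα0
    rw [show (k : ℂ) * (1 - 2 * l) = (((k : ℕ) - ((2 * l * k : ℕ) : ℤ) : ℤ) : ℂ) by push_cast; ring,
      cpow_intCast, ofReal_div, zpow_sub₀ hq, zpow_natCast, zpow_natCast, ← pow_mul, ← pow_mul]
    congr 2
    ring
  have h3 : (-1 : ℂ) ^ ((k : ℤ) * m + k + m) =
      -(((-1) ^ j) ^ k * ((-1) ^ l) ^ k * ((-1) ^ j * (-1) ^ l)) := by
    rw [show (k : ℤ) * m + k + m = ((j * k + l * k + j + l : ℕ) : ℤ) - 1 by rw [hm]; push_cast; ring,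
      zpow_sub₀ (by norm_num), zpow_natCast, zpow_one, pow_add, pow_add, pow_add, pow_mul, pow_mul]
    ring
  have h4 : (2 : ℂ) ^ (2 * (k : ℤ) * m) = ((2 ^ j) ^ k * (2 ^ l) ^ k) ^ 2 / 4 ^ k := by
    rw [show 2 * (k : ℤ) * m = (((j * k + l * k) * 2 : ℕ) : ℤ) - ((2 * k : ℕ) : ℤ) by
      rw [hm]; push_cast; ring, zpow_sub₀ two_ne_zero, zpow_natCast, zpow_natCast, pow_mul, pow_add,
      pow_mul, pow_mul, pow_mul]
    norm_num
  have hs : ∀ n : ℕ, ((-1 : ℂ) ^ n) * (-1) ^ n = 1 := fun n => by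
    rw [← mul_pow]; norm_num
  rw [h1, h2, h3, h4, hβ, riemannZeta_two_mul_nat_eq, riemannZeta_two_mul_nat_eq]
  obtain ⟨K, rfl⟩ : ∃ K, k = K + 1 := ⟨k - 1, by omega⟩
  rw [Nat.add_sub_cancel]
  have hsl := hs l
  have hsj := hs j
  have hl0 : ((-1 : ℂ) ^ l) ≠ 0 := left_ne_zero_of_mul_eq_one hsl
  have hfl : (((2 * l).factorial : ℕ) : ℂ) ≠ 0 := by exact_mod_cast Nat.factorial_ne_zero _
  have hfj : (((2 * j).factorial : ℕ) : ℂ) ≠ 0 := by exact_mod_cast Nat.factorial_ne_zero _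
  have hinv : (-(-1 : ℂ) ^ l * (Real.pi / 2))⁻¹ = -(-1) ^ l * (2 / Real.pi) := by
    refine inv_eq_of_mul_eq_one_left ?_
    field_simp
    linear_combination hsl
  have h4' : (4 : ℂ) ^ (K + 1) = 2 ^ (K + 1) * 2 ^ (K + 1) := by rw [← mul_pow]; norm_num
  rw [div_eq_mul_inv _ (-(-1 : ℂ) ^ l * (Real.pi / 2)), hinv, h4']
  have hK : ((-1 : ℂ) ^ (K + 1)) * (-1) ^ (K + 1) = 1 := hs _
  generalize (bernoulli (2 * l) : ℂ) = b₁
  generalize (bernoulli (2 * j) : ℂ) = b₂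
  generalize (((2 * l).factorial : ℕ) : ℂ) = f₁ at *
  generalize (((2 * j).factorial : ℕ) : ℂ) = f₂ at *
  simp only [div_pow, mul_pow, neg_pow ((-1 : ℂ) ^ _)]
  generalize (-1 : ℂ) ^ l = s at *
  generalize (-1 : ℂ) ^ j = r at *
  generalize (-1 : ℂ) ^ (K + 1) = q at *
  field_simp
  rw [one_pow, sq q, hK, sq r, hsj]
  ring

/-- The bound on `N` puts the line in the region of absolute convergence for both zeta factors. -/
theorem hasSum_mainTerm_lineInt {k : ℕ} (hk : 1 ≤ k) {C : ℝ} (hC : C < 0) {m : ℤ} {γ : ℝ} (hγ : 0 < γ)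
    {N : ℕ} (hN : 2 * |m| + 1 ≤ N) :
    HasSum (fun n : ℕ+ => mainTerm C m k γ n) (1 / (2 * Real.pi) * lineInt m k γ (N + 1 / 2)) := by
  have hN1 : (1 : ℝ) ≤ N := by
    have : (1 : ℤ) ≤ N := by linarith [abs_nonneg m]
    exact_mod_cast this
  have hNm : -2 * (m : ℝ) + 1 ≤ N := by
    have : -2 * m + 1 ≤ (N : ℤ) := by linarith [neg_le_abs m]
    exact_mod_cast this
  convert hasSum_mainTerm hk hC (c := N + 1 / 2) (by linarith) (m := m) (by linarith) hγ using 2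
  unfold lineInt
  congr 1
  funext t
  have hne_int : ∀ i : ℤ, ((N + 1 / 2 : ℝ) : ℂ) + t * I ≠ i := by
    intro i h
    have h1 : (N + 1 / 2 : ℝ) = i := by simpa using congrArg re h
    have h2 : (2 * N + 1 : ℝ) = 2 * i := by linarith
    have : (2 * N + 1 : ℤ) = 2 * i := by exact_mod_cast h2
    omega
  exact (mellinKernel_mul_eq_symmKernel hk m hγ (fun n => by simpa using hne_int (-n))
    (by simpa using hne_int 1) (cos_pi_mul_div_two_ne_zero fun i => hne_int _)).symm

theorem bracket_eq {k : ℕ} (hk : 1 ≤ k) {C : ℝ} (hC : C < 0) {m : ℤ} (hm : m ≠ 0) {γ : ℝ}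
    (hγ : 0 < γ) {N : ℕ} (hN : 2 * |m| + 1 ≤ N) :
    bracket C m k γ = 1 / (2 * Real.pi) * (lineInt m k γ (N + 1 / 2) -
      (lineInt m k γ (1 / 2) - lineInt m k γ (-1 / 2))) := by
  have hpi : (Real.pi : ℂ) ≠ 0 := by exact_mod_cast Real.pi_ne_zero
  rw [bracket, (hasSum_mainTerm_lineInt hk hC hγ hN).tsum_eq, lineInt_sub_zero hm hk hγ]
  field_simp

theorem residue_sum_term {k : ℕ} (hk : 1 ≤ k) {α β : ℝ} (hα : 0 < α)
    (hαβ : α * β = Real.pi ^ 2) {m j : ℤ} (hj : j ∈ Finset.Icc (0 : ℤ) (m + 1)) :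
    ((α : ℂ) ^ k) ^ (-m) * (1 / (2 * Real.pi) *
        (lineInt m k α ((2 * (j - m - 1) + 1 : ℤ) + 1 / 2) -
          lineInt m k α ((2 * (j - m - 1) + 1 : ℤ) - 1 / 2))) =
      (-1 : ℂ) ^ ((k : ℤ) * m + k + m) * ((Real.pi : ℂ) / 2) ^ (k - 1) *
        (2 : ℂ) ^ (2 * (k : ℤ) * m) *
          ((-1 : ℂ) ^ j *
            (((bernoulli (2 * m - 2 * j + 2).toNat : ℚ) : ℂ) ^ k *
              ((bernoulli (2 * j).toNat : ℚ) : ℂ) ^ k) /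
            (((2 * m - 2 * j + 2).toNat.factorial : ℂ) ^ k *
              ((2 * j).toNat.factorial : ℂ) ^ k) *
            (α : ℂ) ^ ((k : ℤ) * (m + 1 - j)) * (β : ℂ) ^ ((k : ℤ) * j)) := by
  have hpi : (Real.pi : ℂ) ≠ 0 := by exact_mod_cast Real.pi_ne_zero
  rw [Finset.mem_Icc] at hj
  obtain ⟨i, rfl⟩ : ∃ i : ℕ, j = i := ⟨j.toNat, by omega⟩
  obtain ⟨l, hl⟩ : ∃ l : ℕ, m + 1 - i = l := ⟨(m + 1 - i).toNat, by omega⟩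
  have hm : m = i + l - 1 := by omega
  have hcast : (m : ℂ) = i + l - 1 := by rw [hm]; push_cast; rfl
  have e1 : (2 * m - 2 * (i : ℤ) + 2).toNat = 2 * l := by omega
  have e2 : (2 * (i : ℤ)).toNat = 2 * i := by omega
  have hsign : (-1 : ℂ) ^ ((i : ℤ) - m - 1) = (-1) ^ l := by
    rw [show (i : ℤ) - m - 1 = -(l : ℤ) by omega, zpow_neg, zpow_natCast, ← inv_pow]
    norm_num
  rw [e1, e2, hl, zpow_natCast, lineInt_sub_of_odd m k hα, hsign,
    show (1 : ℂ) - ((2 * ((i : ℤ) - m - 1) + 1 : ℤ) : ℂ) = 2 * l by push_cast; rw [hcast]; ring,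
    show (2 * (m : ℂ) + 1 + ((2 * ((i : ℤ) - m - 1) + 1 : ℤ) : ℂ)) = 2 * i by push_cast; ring,
    show (((2 * ((i : ℤ) - m - 1) + 1 : ℤ) : ℂ)) = 1 - 2 * l by push_cast; rw [hcast]; ring,
    show (k : ℤ) * l = ((l * k : ℕ) : ℤ) by push_cast; ring,
    show (k : ℤ) * i = ((i * k : ℕ) : ℤ) by push_cast; ring, zpow_natCast, zpow_natCast, pow_mul,
    pow_mul, ← residue_term_eq hk hα hαβ i l hm]
  field_simp

end

theorem theorem1p1 (k : ℕ) (hk : 1 ≤ k) (m : ℤ) (hm : m ≠ 0) (α β : ℝ) (hα : 0 < α) (hβ : 0 < β)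
    (hαβ : α * β = Real.pi ^ 2) (C : ℝ) (hC : C < 0) :
    -- the integrals that define the G-functions converge absolutely
    (∀ z : ℝ, 0 < z → MeasureTheory.Integrable fun t : ℝ =>
      meijerGIntegrand [] [] (lowerLeft k) (lowerRight k) (z : ℂ) ((C : ℂ) + (t : ℂ) * Complex.I)) ∧
    -- the series that defines `Ψ_{ρ,k}(x)` converges
    (∀ ρ x : ℝ, 0 < ρ → 0 < x → Summable fun j : ℕ+ => psiTerm C ρ k x j) ∧
    -- the two series in the formula converge
    (Summable fun n : ℕ+ => mainTerm C m k α n) ∧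
    (Summable fun n : ℕ+ => mainTerm C m k β n) ∧
    ((α : ℂ) ^ k) ^ (-m) * bracket C m k α =
      (-(β : ℂ) ^ k) ^ (-m) * bracket C m k β +
      (-1 : ℂ) ^ ((k : ℤ) * m + k + m) * ((Real.pi : ℂ) / 2) ^ (k - 1) *
        (2 : ℂ) ^ (2 * (k : ℤ) * m) *
        ∑ j ∈ Finset.Icc (0 : ℤ) (m + 1),
          (-1 : ℂ) ^ j *
            (((bernoulli (2 * m - 2 * j + 2).toNat : ℚ) : ℂ) ^ k *
              ((bernoulli (2 * j).toNat : ℚ) : ℂ) ^ k) /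
            (((2 * m - 2 * j + 2).toNat.factorial : ℂ) ^ k *
              ((2 * j).toNat.factorial : ℂ) ^ k) *
            (α : ℂ) ^ ((k : ℤ) * (m + 1 - j)) * (β : ℂ) ^ ((k : ℤ) * j) := by
  obtain ⟨N, hN'⟩ := exists_nat_ge (2 * |m| + 1)
  have hN : 2 * |m| + 1 ≤ (N : ℤ) := by exact_mod_cast hN'
  refine ⟨fun z hz => integrable_meijerGIntegrand hk hC hz,
    fun ρ x hρ hx => (hasSum_psiTerm hk hC one_lt_two hρ hx).summable,
    (hasSum_mainTerm_lineInt hk hC hα hN).summable, (hasSum_mainTerm_lineInt hk hC hβ hN).summable, ?_⟩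
  rw [Finset.mul_sum, ← Finset.sum_congr rfl fun j hj => residue_sum_term hk hα hαβ hj,
    ← Finset.mul_sum, ← Finset.mul_sum, bracket_eq hk hC hm hα hN, bracket_eq hk hC hm hβ hN]
  have hres := lineInt_sub_eq_residues hm hk hα hN
  have r1 := lineInt_reflect k m hα hβ hαβ (N + 1 / 2)
  have r2 := lineInt_reflect k m hα hβ hαβ (1 / 2)
  have r3 := lineInt_reflect k m hα hβ hαβ (-1 / 2)
  rw [show -2 * (m : ℝ) - -1 / 2 = -2 * m + 1 / 2 by ring] at r3
  -- `r1` turns the far left `α`-line into the right `β`-line. `r2` and `r3` turn the `α`-residue at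
  -- `-2m` into minus the `β`-residue at `0`, completing the bracket for `β`.
  linear_combination (((α : ℂ) ^ k) ^ (-m) * (1 / (2 * Real.pi))) * hres +
    (1 / (2 * Real.pi : ℂ)) * (r1 - r2 + r3)
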